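/- **Setting.** Let $\mu$ be a $\sigma$-finite measure on a measurable space (for instance Lebesgue or counting measure); write $dx$ for $\mu(dx)$. Let $\Theta\subset\mathbb R^p$, let $\{f_\theta:\theta\in\Theta\}$ be probability densities and $g$ a probability density with respect to $\mu$, and let $X_1,X_2,\dots$ be i.i.d. with density $g$; $g$ need not belong to the model. Let $\alpha\in\mathbb R$, $\beta\ge 0$, $u_\theta(x)=\frac{\partial}{\partial\theta}\log f_\theta(x)$ and $I_\theta(x)=-\frac{\partial}{\partial\theta}u_\theta(x)$. The generalized B-exponential estimating equation is $$\frac1n\sum_{i=1}^n u_\theta(X_i)f_\theta^{\beta}(X_i)e^{\alpha f_\theta(X_i)}-\int u_\theta(x)f_\theta^{1+\beta}(x)e^{\alpha f_\theta(x)}\,dx=0,\qquad\theta\in\Theta. \qquad (1)$$ Let $\theta_{\alpha,\beta}\in\Theta$ be a best-fitting parameter, that is, a root of the population version $$\int u_\theta f_\theta^{\beta}e^{\alpha f_\theta}g\,dx-\int u_\theta f_\theta^{1+\beta}e^{\alpha f_\theta}\,dx=0 .$$ Define $\xi(\theta)=\int u_\theta f_\theta^\beta e^{\alpha f_\theta}g\,dx$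 and $$J(\theta)=\int u_\theta u_\theta^T f_\theta^{1+\beta}e^{\alpha f_\theta}dx+\int\{I_\theta-\beta u_\theta u_\theta^T-\alpha u_\theta u_\theta^T f_\theta\}\{g-f_\theta\}f_\theta^\beta e^{\alpha f_\theta}dx,$$ $$K(\theta)=\int u_\theta u_\theta^T f_\theta^{2\beta}e^{2\alpha f_\theta}g\,dx-\xi(\theta)\xi(\theta)^T,$$ $$V_\theta(x)=u_\theta(x)f_\theta^\beta(x)e^{\alpha f_\theta(x)}-\int u_\theta(y)f_\theta^{1+\beta}(y)e^{\alpha f_\theta(y)}dy .$$ **Assumptions.** - (D1) The set $\mathcal X=\{x: f_\theta(x)>0\}$ does not depend on $\theta\in\Theta$, and, up to a $\mu$-null set, $g>0$ exactly on $\mathcal X$. - (D2) There is an open set $\omega\subset\Theta$ containing $\theta_{\alpha,\beta}$ such that, for almost all $x\in\mathcal X$, $f_\theta(x)$ is three times differentiable in $\theta\in\omega$ with continuous third partial derivatives. - (D3) On $\omega$ the two integrals $\int u_\theta f_\theta^{1+\beta}e^{\alpha f_\theta}dx$ and $\int u_\theta f_\theta^{\beta}e^{\alpha f_\theta}g\,dx$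 converge absolutely and can be differentiated twice with respect to $\theta$ under the integral sign. - (D4) The integrals defining $J(\theta_{\alpha,\beta})$ converge absolutely and $J(\theta_{\alpha,\beta})$ is positive definite. - (D5) There are functions $M_{jkl}$ with $\int |M_{jkl}|\,g\,dx<\infty$ such that, for almost all $x\in\mathcal X$, $\left|\frac{\partial^2}{\partial\theta_k\partial\theta_l}V_{\theta,j}(x)\right|\le M_{jkl}(x)$ for all $\theta\in\omega$ and all $j,k,l$, where $V_{\theta,j}$ is the $j$-th component of $V_\theta$. The integrals defining $K(\theta_{\alpha,\beta})$ are also assumed to converge absolutely. **Theorem 1.** Under these assumptions: (a) Equation (1) has a consistent sequence of roots: there are measurable functions $\hat\theta_n=\hat\theta_n(X_1,\dots,X_n)$ such that the probability that $\hat\theta_n$ solves (1) tends to $1$ and $\hat\theta_n\to\theta_{\alpha,\beta}$ in probability. (b) For every sequence of random vectors $\hat\theta_n$ that solve (1) with probability tending to one and converge to $\theta_{\alpha,\beta}$ in probability, $n^{1/2}(\hat\theta_n-\theta_{\alpha,\beta})$ converges in distribution to the $p$-variate normal distribution with mean zero and covariance matrix $J^{-1}KJ^{-1}$, which is positive semidefinite,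 where $J=J(\theta_{\alpha,\beta})$ and $K=K(\theta_{\alpha,\beta})$. -/

import Mathlib

open MeasureTheory ProbabilityTheory Filter Topology
open scoped ENNReal

noncomputable section

namespace GBEDE

variable {p : ℕ} {𝓧 : Type*} [MeasurableSpace 𝓧]

/-- `h` is a probability density with respect to the dominating measure `μ`. -/
structure IsDensity (μ : Measure 𝓧) (h : 𝓧 → ℝ) : Prop where
  measurable : Measurable h
  nonneg : ∀ x, 0 ≤ h x
  integral_eq_one : ∫ x, h x ∂μ = 1

/-- The distribution with density `h` with respect to `μ`. -/
def distribution (μ : Measure 𝓧) (h : 𝓧 → ℝ) : Measure 𝓧 :=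
  μ.withDensity fun x => ENNReal.ofReal (h x)

/-- The partial derivative of `F` with respect to the `k`-th coordinate, at `θ`. -/
def partialDeriv (k : Fin p) (F : EuclideanSpace ℝ (Fin p) → ℝ)
    (θ : EuclideanSpace ℝ (Fin p)) : ℝ :=
  fderiv ℝ F θ (EuclideanSpace.single k 1)

/-- The likelihood score `u_θ(x)`, the gradient in `θ` of `log f_θ(x)`. It vanishes at every `x`
off the common support, where `f_θ(x)` is zero for all `θ` near the given one. -/
def score (f : EuclideanSpace ℝ (Fin p) → 𝓧 → ℝ) (θ : EuclideanSpace ℝ (Fin p)) (x : 𝓧) :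
    EuclideanSpace ℝ (Fin p) :=
  gradient (fun t => Real.log (f t x)) θ

/-- The `(j, k)` entry of the information function `I_θ(x) = -∂u_θ(x)/∂θ`. -/
def info (f : EuclideanSpace ℝ (Fin p) → 𝓧 → ℝ) (θ : EuclideanSpace ℝ (Fin p)) (x : 𝓧)
    (j k : Fin p) : ℝ :=
  -partialDeriv k (fun t => score f t x j) θ

/-- The weight `f_θ(x) ^ b * exp (a f_θ(x))`. -/
def weight (f : EuclideanSpace ℝ (Fin p) → 𝓧 → ℝ) (a b : ℝ) (θ : EuclideanSpace ℝ (Fin p))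
    (x : 𝓧) : ℝ :=
  f θ x ^ b * Real.exp (a * f θ x)

/-- The weighted score `u_θ(x) f_θ(x) ^ b exp (a f_θ(x))`. -/
def weightedScore (f : EuclideanSpace ℝ (Fin p) → 𝓧 → ℝ) (a b : ℝ)
    (θ : EuclideanSpace ℝ (Fin p)) (x : 𝓧) : EuclideanSpace ℝ (Fin p) :=
  weight f a b θ x • score f θ x

/-- The centring term `∫ u_θ f_θ ^ (1 + β) exp (α f_θ) dμ`. -/
def centring (μ : Measure 𝓧) (f : EuclideanSpace ℝ (Fin p) → 𝓧 → ℝ) (α β : ℝ)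
    (θ : EuclideanSpace ℝ (Fin p)) : EuclideanSpace ℝ (Fin p) :=
  ∫ x, weightedScore f α (1 + β) θ x ∂μ

/-- `ξ(θ) = ∫ u_θ f_θ ^ β exp (α f_θ) g dμ`. -/
def xi (μ : Measure 𝓧) (f : EuclideanSpace ℝ (Fin p) → 𝓧 → ℝ) (g : 𝓧 → ℝ) (α β : ℝ)
    (θ : EuclideanSpace ℝ (Fin p)) : EuclideanSpace ℝ (Fin p) :=
  ∫ x, g x • weightedScore f α β θ x ∂μ

/-- The function `V_θ(x) = ψ(x, θ)` of the M-estimation form of the estimating equation. -/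
def V (μ : Measure 𝓧) (f : EuclideanSpace ℝ (Fin p) → 𝓧 → ℝ) (α β : ℝ)
    (θ : EuclideanSpace ℝ (Fin p)) (x : 𝓧) : EuclideanSpace ℝ (Fin p) :=
  weightedScore f α β θ x - centring μ f α β θ

/-- `θ` is a root, in the parameter space `Θ`, of the generalized B-exponential estimating
equation for the sample `x`. -/
def IsRoot (μ : Measure 𝓧) (f : EuclideanSpace ℝ (Fin p) → 𝓧 → ℝ)
    (Θ : Set (EuclideanSpace ℝ (Fin p))) (α β : ℝ) {n : ℕ} (x : Fin n → 𝓧)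
    (θ : EuclideanSpace ℝ (Fin p)) : Prop :=
  θ ∈ Θ ∧ (n : ℝ)⁻¹ • ∑ i, weightedScore f α β θ (x i) - centring μ f α β θ = 0

/-- `θ` is a root of the theoretical (population) estimating equation under the density `g`. -/
def IsBestFitting (μ : Measure 𝓧) (f : EuclideanSpace ℝ (Fin p) → 𝓧 → ℝ) (g : 𝓧 → ℝ)
    (α β : ℝ) (θ : EuclideanSpace ℝ (Fin p)) : Prop :=
  xi μ f g α β θ - centring μ f α β θ = 0

/-- The integrand of the second integral in the definition of `J`. -/
def jRemainder (f : EuclideanSpace ℝ (Fin p) → 𝓧 → ℝ) (g : 𝓧 → ℝ) (α β : ℝ)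
    (θ : EuclideanSpace ℝ (Fin p)) (j k : Fin p) (x : 𝓧) : ℝ :=
  (info f θ x j k - β * (score f θ x j * score f θ x k)
      - α * (score f θ x j * score f θ x k) * f θ x)
    * (g x - f θ x) * weight f α β θ x

/-- The matrix `J(θ)`. -/
def J (μ : Measure 𝓧) (f : EuclideanSpace ℝ (Fin p) → 𝓧 → ℝ) (g : 𝓧 → ℝ) (α β : ℝ)
    (θ : EuclideanSpace ℝ (Fin p)) : Matrix (Fin p) (Fin p) ℝ :=
  Matrix.of fun j k =>
    (∫ x, score f θ x j * score f θ x k * weight f α (1 + β) θ x ∂μ)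
      + ∫ x, jRemainder f g α β θ j k x ∂μ

/-- The integrals in the definition of `J(θ)` converge absolutely. -/
def JExists (μ : Measure 𝓧) (f : EuclideanSpace ℝ (Fin p) → 𝓧 → ℝ) (g : 𝓧 → ℝ) (α β : ℝ)
    (θ : EuclideanSpace ℝ (Fin p)) : Prop :=
  ∀ j k, Integrable (fun x => score f θ x j * score f θ x k * weight f α (1 + β) θ x) μ ∧
    Integrable (jRemainder f g α β θ j k) μ

/-- The matrix `K(θ)`. -/
def K (μ : Measure 𝓧) (f : EuclideanSpace ℝ (Fin p) → 𝓧 → ℝ) (g : 𝓧 → ℝ) (α β : ℝ)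
    (θ : EuclideanSpace ℝ (Fin p)) : Matrix (Fin p) (Fin p) ℝ :=
  Matrix.of fun j k =>
    (∫ x, score f θ x j * score f θ x k * weight f (2 * α) (2 * β) θ x * g x ∂μ)
      - xi μ f g α β θ j * xi μ f g α β θ k

/-- The first integral in the definition of `K(θ)` converges absolutely (the integral `ξ(θ)`
is covered by the condition `CondD3`). -/
def KExists (μ : Measure 𝓧) (f : EuclideanSpace ℝ (Fin p) → 𝓧 → ℝ) (g : 𝓧 → ℝ) (α β : ℝ)
    (θ : EuclideanSpace ℝ (Fin p)) : Prop :=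
  ∀ j k, Integrable
    (fun x => score f θ x j * score f θ x k * weight f (2 * α) (2 * β) θ x * g x) μ

/-- (D1) Common support of the model densities and of the true density `g`. -/
def CondD1 (μ : Measure 𝓧) (f : EuclideanSpace ℝ (Fin p) → 𝓧 → ℝ) (g : 𝓧 → ℝ)
    (Θ : Set (EuclideanSpace ℝ (Fin p))) (S : Set 𝓧) : Prop :=
  (∀ θ ∈ Θ, {x | 0 < f θ x} = S) ∧ ∀ᵐ x ∂μ, 0 < g x ↔ x ∈ S

/-- (D2) For almost all `x` in the support, `θ ↦ f_θ(x)` is three times differentiable with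
continuous third partial derivatives on the open set `ω` of parameters. -/
def CondD2 (μ : Measure 𝓧) (f : EuclideanSpace ℝ (Fin p) → 𝓧 → ℝ)
    (ω : Set (EuclideanSpace ℝ (Fin p))) (S : Set 𝓧) : Prop :=
  ∀ᵐ x ∂μ, x ∈ S → ContDiffOn ℝ 3 (fun θ => f θ x) ω

/-- The integral `∫ h_θ(x) dμ(x)` converges and can be differentiated once with respect to `θ` on
the open set `ω`, the partial derivatives being taken under the integral sign. -/
structure DiffUnderIntegral (μ : Measure 𝓧) (h : EuclideanSpace ℝ (Fin p) → 𝓧 → ℝ)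
    (ω : Set (EuclideanSpace ℝ (Fin p))) : Prop where
  integrable : ∀ θ ∈ ω, Integrable (h θ) μ
  integrable_partialDeriv : ∀ θ ∈ ω, ∀ k,
    Integrable (fun x => partialDeriv k (fun t => h t x) θ) μ
  differentiableAt : ∀ θ ∈ ω, DifferentiableAt ℝ (fun t => ∫ x, h t x ∂μ) θ
  partialDeriv_integral : ∀ θ ∈ ω, ∀ k,
    partialDeriv k (fun t => ∫ x, h t x ∂μ) θ = ∫ x, partialDeriv k (fun t => h t x) θ ∂μ

/-- The integral `∫ h_θ(x) dμ(x)` can be differentiated twice with respect to `θ` on `ω` under the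
integral sign: once, and then the integral of each partial derivative once more. -/
def TwiceDiffUnderIntegral (μ : Measure 𝓧) (h : EuclideanSpace ℝ (Fin p) → 𝓧 → ℝ)
    (ω : Set (EuclideanSpace ℝ (Fin p))) : Prop :=
  DiffUnderIntegral μ h ω ∧
    ∀ k, DiffUnderIntegral μ (fun θ x => partialDeriv k (fun t => h t x) θ) ω

/-- (D3) The two integrals of the estimating equation, which are the gradients of the two terms
of the objective function, can be differentiated twice (so the objective function three times)
under the integral sign, component by component. -/
def CondD3 (μ : Measure 𝓧) (f : EuclideanSpace ℝ (Fin p) → 𝓧 → ℝ) (g : 𝓧 → ℝ) (α β : ℝ)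
    (ω : Set (EuclideanSpace ℝ (Fin p))) : Prop :=
  ∀ j, TwiceDiffUnderIntegral μ (fun θ x => weightedScore f α (1 + β) θ x j) ω ∧
    TwiceDiffUnderIntegral μ (fun θ x => weightedScore f α β θ x j * g x) ω

/-- (D4) The matrix `J(θ)` (exists and) is positive definite. -/
def CondD4 (μ : Measure 𝓧) (f : EuclideanSpace ℝ (Fin p) → 𝓧 → ℝ) (g : 𝓧 → ℝ) (α β : ℝ)
    (θ : EuclideanSpace ℝ (Fin p)) : Prop :=
  JExists μ f g α β θ ∧ (J μ f g α β θ).PosDef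

/-- (D5) The second partial derivatives of the components of `V_θ(x)` are dominated on `ω` by
functions `M j k l` of `x` with finite expectation under the true distribution. -/
def CondD5 (μ : Measure 𝓧) (f : EuclideanSpace ℝ (Fin p) → 𝓧 → ℝ) (g : 𝓧 → ℝ) (α β : ℝ)
    (ω : Set (EuclideanSpace ℝ (Fin p))) (S : Set 𝓧) : Prop :=
  ∃ M : Fin p → Fin p → Fin p → 𝓧 → ℝ,
    (∀ j k l, Integrable (M j k l) (distribution μ g)) ∧
    ∀ᵐ x ∂μ, x ∈ S → ∀ θ ∈ ω, ∀ j k l,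
      |partialDeriv k (partialDeriv l fun t => V μ f α β t x j) θ| ≤ M j k l x

/-- `θhat n`, `n = 1, 2, …`, is a consistent sequence of roots of the estimating equation for the
samples `X 0, …, X (n - 1)`: with probability tending to one `θhat n` is a root, and `θhat n`
converges in probability to `θ₀`. -/
structure IsConsistentRootSequence {Ω : Type*} [MeasurableSpace Ω] (P : Measure Ω)
    (X : ℕ → Ω → 𝓧) (μ : Measure 𝓧) (f : EuclideanSpace ℝ (Fin p) → 𝓧 → ℝ)
    (Θ : Set (EuclideanSpace ℝ (Fin p))) (α β : ℝ) (θ₀ : EuclideanSpace ℝ (Fin p))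
    (θhat : ℕ → Ω → EuclideanSpace ℝ (Fin p)) : Prop where
  aemeasurable : ∀ n, AEMeasurable (θhat n) P
  root : Tendsto
    (fun n : ℕ => P {w | ¬ IsRoot μ f Θ α β (fun i : Fin n => X i w) (θhat n w)}) atTop (𝓝 0)
  consistent : TendstoInMeasure P θhat atTop fun _ => θ₀

end GBEDE

end

/-! The left side F of the estimating equation is the sample mean of V_θ. At θ₀ the function V has
mean zero by the best-fitting equation, its Jacobian has mean -J (`integral_partialDeriv_V`), and
its covariance matrix is K (`covariance_weightedScore`, since V is the weighted score minus a
constant). Domination of the second derivatives gives V_θ - V_θ' = A (θ - θ') up to M ρ |θ - θ'| for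
all θ, θ' within ρ of θ₀, where A is the Jacobian at θ₀ and M is integrable. The law of large
numbers is therefore needed only for A, M and V at θ₀, and no uniform law enters.

Existence: with probability tending to one, θ ↦ θ + J⁻¹ F(θ) is a 1/2-contraction of a fixed small
ball into itself. Its fixed point is a root within 2 |J⁻¹ F(θ₀)| of θ₀, and this bound tends to zero
in probability. The root is the limit of iterates started at θ₀, each measurable in the sample, so
no measurable selection is required (`exists_zero_tendsto_newtonStep`, `exists_measurable_zero`).

Normality: for any consistent root the expansion with ρ = |θhat - θ₀| gives |(θhat - θ₀) - J⁻¹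
F(θ₀)| ≤ η |θhat - θ₀| with η → 0 in probability, hence at most 2 η |J⁻¹ F(θ₀)| once η < 1/2. After
scaling by √n this vanishes by Slutsky, and the central limit theorem for J⁻¹ V supplies the limit
(`RegularEstimatingFunction.tendstoInDistribution`, `tendstoInDistribution_influence`).

The assumptions hold only almost everywhere, so V is cut off outside a measurable set of full
probability, which almost surely contains the whole sample (`exists_regularEstimatingFunction`).
Positive definiteness of J is used only for its invertibility and symmetry. -/

namespace GBEDE

/-! ### Limit theorems for i.i.d. samples -/

section Limits

variable {Ω : Type*} [MeasurableSpace Ω] {P : Measure Ω}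

lemma tendsto_measure_zero_of_subset_union {s t u : ℕ → Set Ω}
    (hs : Tendsto (fun n => P (s n)) atTop (𝓝 0)) (ht : Tendsto (fun n => P (t n)) atTop (𝓝 0))
    (h : ∀ n, u n ⊆ s n ∪ t n) : Tendsto (fun n => P (u n)) atTop (𝓝 0) := by
  have hst := hs.add ht
  rw [add_zero] at hst
  exact tendsto_of_tendsto_of_tendsto_of_le_of_le tendsto_const_nhds hst (fun _ => zero_le)
    fun n => (measure_mono (h n)).trans (measure_union_le _ _)

/-- Convergence in distribution to a constant implies convergence in probability. -/
lemma tendstoInMeasure_of_tendstoInDistribution_const [IsProbabilityMeasure P]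
    {Ω' : Type*} [MeasurableSpace Ω'] {P' : Measure Ω'} [IsProbabilityMeasure P']
    {E : Type*} [NormedAddCommGroup E] [MeasurableSpace E] [BorelSpace E] {Y : ℕ → Ω → E} {c : E}
    (h : TendstoInDistribution Y atTop (fun _ : Ω' => c) (fun _ => P) P') :
    TendstoInMeasure P Y atTop fun _ => c := by
  rw [tendstoInMeasure_iff_norm]
  intro ε hε
  have hcl : IsClosed {y : E | ε ≤ ‖y - c‖} := isClosed_le continuous_const (by fun_prop)
  have hlim := ProbabilityMeasure.limsup_measure_closed_le_of_tendsto h.tendsto hcl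
  have hzero : P'.map (fun _ => c) {y : E | ε ≤ ‖y - c‖} = 0 := by
    rw [Measure.map_apply measurable_const hcl.measurableSet]
    simp [hε.not_ge]
  have heq : ∀ n, (P.map (Y n)) {y : E | ε ≤ ‖y - c‖} = P {w | ε ≤ ‖Y n w - c‖} := fun n => by
    rw [Measure.map_apply_of_aemeasurable (h.forall_aemeasurable n) hcl.measurableSet]; rfl
  refine tendsto_of_le_liminf_of_limsup_le zero_le ?_
  refine le_trans (le_of_eq ?_) (hlim.trans hzero.le)
  simp [heq]

lemma iIndepFun_comp_of_hasLaw {𝓧 F : Type*} [MeasurableSpace 𝓧] [MeasurableSpace F]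
    {Q : Measure 𝓧} {X : ℕ → Ω → 𝓧} (hindep : iIndepFun X P) (hlaw : ∀ i, HasLaw (X i) Q P)
    {h : 𝓧 → F} (hh : AEMeasurable h Q) : iIndepFun (fun i w => h (X i w)) P :=
  hindep.comp₀ (fun _ => h) (fun i => (hlaw i).aemeasurable)
    fun i => by rw [(hlaw i).map_eq]; exact hh

lemma identDistrib_comp_of_hasLaw {𝓧 F : Type*} [MeasurableSpace 𝓧] [MeasurableSpace F]
    {Q : Measure 𝓧} {X : ℕ → Ω → 𝓧} (hlaw : ∀ i, HasLaw (X i) Q P)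
    {h : 𝓧 → F} (hh : AEMeasurable h Q) (i : ℕ) :
    IdentDistrib (fun w => h (X i w)) (fun w => h (X 0 w)) P P := by
  have hid : IdentDistrib (X i) (X 0) P P :=
    ⟨(hlaw i).aemeasurable, (hlaw 0).aemeasurable, by rw [(hlaw i).map_eq, (hlaw 0).map_eq]⟩
  exact hid.comp_of_aemeasurable (by rw [(hlaw i).map_eq]; exact hh)

/-- The weak law of large numbers for integrable functions of an i.i.d. sample. -/
lemma tendstoInMeasure_sample_mean [IsProbabilityMeasure P]
    {𝓧 F : Type*} [MeasurableSpace 𝓧] [NormedAddCommGroup F] [NormedSpace ℝ F]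
    [FiniteDimensional ℝ F] [MeasurableSpace F] [BorelSpace F]
    {Q : Measure 𝓧} {X : ℕ → Ω → 𝓧} (hindep : iIndepFun X P) (hlaw : ∀ i, HasLaw (X i) Q P)
    {h : 𝓧 → F} (hh : Integrable h Q) :
    TendstoInMeasure P (fun (n : ℕ) w => (n : ℝ)⁻¹ • ∑ i : Fin n, h (X i w)) atTop
      fun _ => ∫ x, h x ∂Q := by
  have : CompleteSpace F := FiniteDimensional.complete ℝ F
  have : ProperSpace F := FiniteDimensional.proper ℝ F
  have hae : AEMeasurable h Q := hh.aemeasurable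
  have hmeas : ∀ i, AEMeasurable (fun w => h (X i w)) P := fun i =>
    (identDistrib_comp_of_hasLaw hlaw hae i).aemeasurable_fst
  have hint : Integrable (fun w => h (X 0 w)) P := by
    have := hh
    rw [← (hlaw 0).map_eq] at this
    exact this.comp_aemeasurable (hlaw 0).aemeasurable
  have hslln := strong_law_ae (fun i w => h (X i w)) hint
    (fun i j hij => (iIndepFun_comp_of_hasLaw hindep hlaw hae).indepFun hij)
    (identDistrib_comp_of_hasLaw hlaw hae)
  have hexp : ∫ w, h (X 0 w) ∂P = ∫ x, h x ∂Q := (hlaw 0).integral_comp hh.aestronglyMeasurable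
  refine tendstoInMeasure_of_tendsto_ae (fun n => ?_) ?_
  · have hsum : AEMeasurable (fun w => ∑ i : Fin n, h (X i w)) P :=
      Finset.aemeasurable_fun_sum _ fun i _ => hmeas i
    exact (hsum.const_smul (n : ℝ)⁻¹).aestronglyMeasurable
  · filter_upwards [hslln] with w hw
    simp only [hexp] at hw
    refine hw.congr fun n => ?_
    rw [Finset.sum_range]

open scoped RealInnerProductSpace Matrix in
/-- The multivariate central limit theorem for centred i.i.d. square-integrable vectors. -/
theorem tendstoInDistribution_inv_sqrt_smul_sum [IsProbabilityMeasure P]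
    {ι : Type*} [Fintype ι] [DecidableEq ι] {Y : ℕ → Ω → EuclideanSpace ℝ ι} {S : Matrix ι ι ℝ}
    (hS : S.PosSemidef) (hvar : ∀ t, Var[fun w => ⟪Y 0 w, t⟫; P] = t ⬝ᵥ S *ᵥ t)
    (h0 : P[Y 0] = 0) (hY : MemLp (Y 0) 2 P) (hindep : iIndepFun Y P)
    (hident : ∀ i, IdentDistrib (Y i) (Y 0) P P) :
    TendstoInDistribution (fun (n : ℕ) w => (√n)⁻¹ • ∑ k ∈ Finset.range n, Y k w) atTop
      (id : EuclideanSpace ℝ ι → EuclideanSpace ℝ ι) (fun _ => P) (multivariateGaussian 0 S) := by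
  have hYm : ∀ i, AEMeasurable (Y i) P := fun i => (hident i).aemeasurable_fst
  have hsm : ∀ n : ℕ, AEMeasurable (fun w => (√n)⁻¹ • ∑ k ∈ Finset.range n, Y k w) P := fun n =>
    (Finset.aemeasurable_fun_sum _ fun i _ => hYm i).fun_const_smul _
  refine ⟨hsm, by fun_prop, ?_⟩
  -- Cramér–Wold: the characteristic function at `t` is that of the projection onto `t` at 1, so the
  -- scalar central limit theorem suffices.
  refine ProbabilityMeasure.tendsto_iff_tendsto_charFun.2 fun t => ?_
  have hin : Measurable fun y : EuclideanSpace ℝ ι => ⟪y, t⟫ := by fun_prop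
  have hmean : ∫ w, ⟪Y 0 w, t⟫ ∂P = 0 := by
    have := integral_inner (𝕜 := ℝ) (hY.integrable (by norm_num)) t
    simp_rw [real_inner_comm t]
    simp [this, h0]
  have hclt := tendstoInDistribution_inv_sqrt_mul_sum_sub (P := P)
    (X := fun i w => ⟪Y i w, t⟫) (Y := id)
    (P' := gaussianReal 0 Var[fun w => ⟪Y 0 w, t⟫; P].toNNReal)
    ⟨by fun_prop, by simp⟩ (hY.inner_const t) (hindep.comp (fun _ y => ⟪y, t⟫) fun _ => hin)
    fun i => (hident i).comp hin
  have h1 := ProbabilityMeasure.tendsto_iff_tendsto_charFun.1 hclt.tendsto 1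
  simp only [ProbabilityMeasure.coe_mk, Measure.map_id, charFun_gaussianReal,
    charFun_multivariateGaussian hS] at h1 ⊢
  convert h1 using 2 with n
  · rw [charFun_apply, integral_map (hsm n) (by fun_prop), charFun_apply, integral_map
      (hclt.forall_aemeasurable n) (by fun_prop)]
    simp [hmean, inner_smul_left, sum_inner]
  · rw [hvar, Real.coe_toNNReal _ (by simpa using hS.dotProduct_mulVec_nonneg t.ofLp)]
    simp

end Limits

/-! ### Simplified Newton iteration -/

section NewtonStep

variable {E : Type*} [NormedAddCommGroup E] [NormedSpace ℝ E]

/-- The radial retraction onto the closed ball of radius `r` around `θ₀`. -/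
noncomputable def radialRetraction (θ₀ : E) (r : ℝ) (θ : E) : E :=
  θ₀ + (r / max r ‖θ - θ₀‖) • (θ - θ₀)

lemma continuous_radialRetraction (θ₀ : E) {r : ℝ} (hr : 0 < r) :
    Continuous (radialRetraction θ₀ r) := by
  unfold radialRetraction
  refine continuous_const.add (Continuous.smul (continuous_const.div (by fun_prop) fun θ => ?_)
    (by fun_prop))
  exact (lt_max_of_lt_left hr).ne'

lemma radialRetraction_mem (θ₀ : E) {r : ℝ} (hr : 0 < r) (θ : E) :
    radialRetraction θ₀ r θ ∈ Metric.closedBall θ₀ r := by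
  have hm : 0 < max r ‖θ - θ₀‖ := lt_max_of_lt_left hr
  rw [mem_closedBall_iff_norm, radialRetraction, add_sub_cancel_left, norm_smul,
    Real.norm_of_nonneg (by positivity), div_mul_eq_mul_div, div_le_iff₀ hm]
  exact mul_le_mul_of_nonneg_left (le_max_right _ _) hr.le

lemma radialRetraction_eq_self {θ₀ : E} {r : ℝ} (hr : 0 < r) {θ : E}
    (hθ : θ ∈ Metric.closedBall θ₀ r) : radialRetraction θ₀ r θ = θ := by
  rw [mem_closedBall_iff_norm] at hθ
  rw [radialRetraction, max_eq_left hθ, div_self hr.ne', one_smul, add_sub_cancel]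

/-- One step of the simplified Newton iteration for a zero of `F`, preceded by the retraction onto
the closed ball of radius `r` around `θ₀`. -/
noncomputable def newtonStep (G : E →L[ℝ] E) (F : E → E) (θ₀ : E) (r : ℝ) (θ : E) : E :=
  radialRetraction θ₀ r θ + G (F (radialRetraction θ₀ r θ))

variable {G J A : E →L[ℝ] E} {F : E → E} {θ₀ : E} {m r : ℝ}

/-- Writing θ - θ' as G J (θ - θ') turns the difference of two steps into G applied to (A + J)(θ -
θ') plus the linearization error. Both are small when A is close to -J and `r` is small. -/
lemma norm_newton_sub_newton_le (hGJ : G ∘L J = .id ℝ E) {θ θ' : E}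
    (hlin : ‖F θ - F θ' - A (θ - θ')‖ ≤ m * r * ‖θ - θ'‖) :
    ‖(θ + G (F θ)) - (θ' + G (F θ'))‖ ≤ ‖G‖ * (‖A + J‖ + m * r) * ‖θ - θ'‖ := by
  have hGJ' : ∀ v, G (J v) = v := fun v => congrArg (fun L : E →L[ℝ] E => L v) hGJ
  have heq : (θ + G (F θ)) - (θ' + G (F θ'))
      = G ((A + J) (θ - θ') + (F θ - F θ' - A (θ - θ'))) := by
    simp only [map_add, map_sub, add_apply, hGJ']
    abel
  rw [heq]
  calc _ ≤ ‖G‖ * (‖A + J‖ * ‖θ - θ'‖ + m * r * ‖θ - θ'‖) :=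
        (G.le_opNorm _).trans (mul_le_mul_of_nonneg_left ((norm_add_le _ _).trans
          (add_le_add ((A + J).le_opNorm _) hlin)) (norm_nonneg _))
    _ = _ := by ring

/-- If `F` is close to the invertible linear map `-J` on a ball and small at its centre, then
the simplified Newton iteration converges to a zero of `F`. -/
lemma exists_zero_tendsto_newtonStep [CompleteSpace E] (hr : 0 < r) (hGJ : G ∘L J = .id ℝ E)
    (hJG : J ∘L G = .id ℝ E)
    (hlin : ∀ θ ∈ Metric.closedBall θ₀ r, ∀ θ' ∈ Metric.closedBall θ₀ r,
      ‖F θ - F θ' - A (θ - θ')‖ ≤ m * r * ‖θ - θ'‖)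
    (hc : ‖G‖ * (‖A + J‖ + m * r) ≤ 1 / 2) (h0 : ‖G (F θ₀)‖ ≤ r / 2) :
    ∃ y ∈ Metric.closedBall θ₀ r, F y = 0 ∧ ‖y - θ₀‖ ≤ 2 * ‖G (F θ₀)‖ ∧
      Tendsto (fun k => (newtonStep G F θ₀ r)^[k] θ₀) atTop (𝓝 y) := by
  have hstep : ∀ θ ∈ Metric.closedBall θ₀ r, newtonStep G F θ₀ r θ = θ + G (F θ) := fun θ hθ => by
    rw [newtonStep, radialRetraction_eq_self hr hθ]
  have hmem₀ : θ₀ ∈ Metric.closedBall θ₀ r := Metric.mem_closedBall_self hr.le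
  have hcontr : ∀ θ ∈ Metric.closedBall θ₀ r, ∀ θ' ∈ Metric.closedBall θ₀ r,
      ‖newtonStep G F θ₀ r θ - newtonStep G F θ₀ r θ'‖ ≤ 1 / 2 * ‖θ - θ'‖ := fun θ hθ θ' hθ' => by
    rw [hstep θ hθ, hstep θ' hθ']
    exact (norm_newton_sub_newton_le hGJ (hlin θ hθ θ' hθ')).trans
      (mul_le_mul_of_nonneg_right hc (norm_nonneg _))
  have hbase : ∀ θ ∈ Metric.closedBall θ₀ r,
      ‖newtonStep G F θ₀ r θ - θ₀‖ ≤ 1 / 2 * ‖θ - θ₀‖ + ‖G (F θ₀)‖ := fun θ hθ => by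
    have h1 := hcontr θ hθ θ₀ hmem₀
    have h2 : newtonStep G F θ₀ r θ - θ₀
        = (newtonStep G F θ₀ r θ - newtonStep G F θ₀ r θ₀) + G (F θ₀) := by
      rw [hstep θ₀ hmem₀]; abel
    rw [h2]
    exact (norm_add_le _ _).trans (by linarith)
  -- The contraction leaves r/2 and the displacement of the centre adds at most r/2.
  have hmaps : Set.MapsTo (newtonStep G F θ₀ r) (Metric.closedBall θ₀ r)
      (Metric.closedBall θ₀ r) := fun θ hθ => by
    have h1 := hbase θ hθ
    rw [mem_closedBall_iff_norm] at hθ ⊢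
    linarith
  have hcw : ContractingWith (1 / 2) (hmaps.restrict (newtonStep G F θ₀ r) _ _) := by
    refine ⟨by rw [← NNReal.coe_lt_coe]; norm_num, LipschitzWith.of_dist_le_mul fun θ θ' => ?_⟩
    simpa [Subtype.dist_eq, dist_eq_norm] using hcontr θ θ.2 θ' θ'.2
  obtain ⟨y, hy, hfix, htend, -⟩ := hcw.exists_fixedPoint' Metric.isClosed_closedBall.isComplete
    hmaps hmem₀ (edist_ne_top _ _)
  have hfix' : newtonStep G F θ₀ r y = y := hfix
  have hGF : G (F y) = 0 := by
    rw [hstep y hy] at hfix'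
    simpa using hfix'
  refine ⟨y, hy, ?_, ?_, htend⟩
  · have := congrArg (fun L : E →L[ℝ] E => L (F y)) hJG
    simpa [hGF] using this.symm
  -- At a fixed point the term 1/2 ‖y - θ₀‖ is absorbed into the left side.
  · have := hbase y hy
    rw [hfix'] at this
    linarith

/-- The error of one simplified Newton step from `θ₀` towards a zero of `F`. -/
lemma norm_sub_newton_le_of_zero (hGJ : G ∘L J = .id ℝ E) {θ : E}
    (hlin : ‖F θ - F θ₀ - A (θ - θ₀)‖ ≤ m * r * ‖θ - θ₀‖) (hθ : F θ = 0) :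
    ‖(θ - θ₀) - G (F θ₀)‖ ≤ ‖G‖ * (‖A + J‖ + m * r) * ‖θ - θ₀‖ := by
  have := norm_newton_sub_newton_le hGJ hlin
  simpa [hθ, sub_add_eq_sub_sub] using this

end NewtonStep

/-! ### Zeros of a regular estimating function -/

section EstimatingFunction

variable {𝓧 : Type*} [MeasurableSpace 𝓧]

/-- The mean of a function over a sample. -/
noncomputable def sampleMean {F : Type*} [AddCommGroup F] [Module ℝ F] {n : ℕ} (h : 𝓧 → F)
    (x : Fin n → 𝓧) : F :=
  (n : ℝ)⁻¹ • ∑ i, h (x i)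

variable {E : Type*} [NormedAddCommGroup E] [NormedSpace ℝ E] [MeasurableSpace E]

/-- Regularity near `θ₀` of an estimating function `ψ` under the distribution `Q`: it is linear up
to a dominated quadratic error, with mean derivative `-J` at `θ₀`. -/
structure RegularEstimatingFunction (Q : Measure 𝓧) (ψ : E → 𝓧 → E) (A : 𝓧 → E →L[ℝ] E)
    (M : 𝓧 → ℝ) (J : E →L[ℝ] E) (θ₀ : E) (r₀ : ℝ) : Prop where
  pos : 0 < r₀
  measurable : ∀ θ ∈ Metric.closedBall θ₀ r₀, Measurable (ψ θ)
  integrable_deriv : Integrable A Q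
  integral_deriv : ∫ x, A x ∂Q = -J
  integrable_bound : Integrable M Q
  bound_nonneg : ∀ x, 0 ≤ M x
  linearization : ∀ x, ∀ ρ ≤ r₀, ∀ θ ∈ Metric.closedBall θ₀ ρ, ∀ θ' ∈ Metric.closedBall θ₀ ρ,
    ‖ψ θ x - ψ θ' x - A x (θ - θ')‖ ≤ M x * ρ * ‖θ - θ'‖
  integrable : Integrable (ψ θ₀) Q
  integral_eq_zero : ∫ x, ψ θ₀ x ∂Q = 0

namespace RegularEstimatingFunction

variable {Q : Measure 𝓧} {ψ : E → 𝓧 → E} {A : 𝓧 → E →L[ℝ] E} {M : 𝓧 → ℝ} {J : E →L[ℝ] E}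
  {θ₀ : E} {r₀ : ℝ}

/-- The estimate is additive in ψ, A and M together, so it averages. The radius ρ stays free:
existence takes it fixed and small, normality takes it to be the distance from the root to θ₀. -/
lemma sampleMean_linearization (h : RegularEstimatingFunction Q ψ A M J θ₀ r₀) {n : ℕ}
    (x : Fin n → 𝓧) {ρ : ℝ} (hρ : ρ ≤ r₀) {θ θ' : E} (hθ : θ ∈ Metric.closedBall θ₀ ρ)
    (hθ' : θ' ∈ Metric.closedBall θ₀ ρ) :
    ‖sampleMean (ψ θ) x - sampleMean (ψ θ') x - sampleMean A x (θ - θ')‖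
      ≤ sampleMean M x * ρ * ‖θ - θ'‖ := by
  have heq : sampleMean (ψ θ) x - sampleMean (ψ θ') x - sampleMean A x (θ - θ')
      = (n : ℝ)⁻¹ • ∑ i, (ψ θ (x i) - ψ θ' (x i) - A (x i) (θ - θ')) := by
    simp only [sampleMean, Finset.sum_sub_distrib, smul_sub, _root_.smul_apply,
      _root_.sum_apply]
  rw [heq, norm_smul, Real.norm_of_nonneg (by positivity), sampleMean, smul_eq_mul, mul_assoc,
    mul_assoc, Finset.sum_mul]
  refine mul_le_mul_of_nonneg_left ((norm_sum_le _ _).trans (Finset.sum_le_sum fun i _ => ?_))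
    (by positivity)
  rw [← mul_assoc]
  exact h.linearization (x i) ρ hρ θ hθ θ' hθ'

lemma continuousOn (h : RegularEstimatingFunction Q ψ A M J θ₀ r₀) (x : 𝓧) :
    ContinuousOn (fun θ => ψ θ x) (Metric.closedBall θ₀ r₀) := by
  refine LipschitzOnWith.continuousOn (K := (‖A x‖ + M x * r₀).toNNReal)
    (LipschitzOnWith.of_dist_le_mul fun θ hθ θ' hθ' => ?_)
  have hpos : 0 ≤ ‖A x‖ + M x * r₀ :=
    add_nonneg (norm_nonneg _) (mul_nonneg (h.bound_nonneg x) h.pos.le)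
  rw [Real.coe_toNNReal _ hpos, dist_eq_norm, dist_eq_norm]
  have h1 := h.linearization x r₀ le_rfl θ hθ θ' hθ'
  have h2 := (A x).le_opNorm (θ - θ')
  have h3 := norm_add_le (ψ θ x - ψ θ' x - A x (θ - θ')) (A x (θ - θ'))
  rw [sub_add_cancel] at h3
  linarith

variable [BorelSpace E] [FiniteDimensional ℝ E]

/-- Carathéodory: thanks to the retraction the step is continuous in θ on the whole space, and it is
measurable in the sample, hence jointly measurable and stable under iteration. -/
lemma measurable_newtonStep_iterate (h : RegularEstimatingFunction Q ψ A M J θ₀ r₀)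
    (G : E →L[ℝ] E) {r : ℝ} (hr : 0 < r) (hrr : r ≤ r₀) (n k : ℕ) :
    Measurable fun x : Fin n → 𝓧 => (newtonStep G (fun θ => sampleMean (ψ θ) x) θ₀ r)^[k] θ₀ := by
  have : ProperSpace E := FiniteDimensional.proper ℝ E
  have hsub : Metric.closedBall θ₀ r ⊆ Metric.closedBall θ₀ r₀ := Metric.closedBall_subset_closedBall hrr
  have hjoint : Measurable (Function.uncurry fun (θ : E) (x : Fin n → 𝓧) =>
      newtonStep G (fun θ => sampleMean (ψ θ) x) θ₀ r θ) := by
    refine measurable_uncurry_of_continuous_of_measurable (fun x => ?_) fun θ => ?_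
    · have hret := continuous_radialRetraction θ₀ hr
      have hψ : ∀ i, Continuous fun θ => ψ (radialRetraction θ₀ r θ) (x i) := fun i =>
        (h.continuousOn (x i)).comp_continuous hret fun θ => hsub (radialRetraction_mem θ₀ hr θ)
      change Continuous fun θ => radialRetraction θ₀ r θ
        + G ((n : ℝ)⁻¹ • ∑ i, ψ (radialRetraction θ₀ r θ) (x i))
      exact hret.add (G.continuous.comp
        ((continuous_finsetSum _ fun i _ => hψ i).const_smul (n : ℝ)⁻¹))
    · have hψ := h.measurable _ (hsub (radialRetraction_mem θ₀ hr θ))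
      unfold newtonStep sampleMean
      fun_prop
  induction k with
  | zero => exact measurable_const
  | succ k ih =>
    simp only [Function.iterate_succ_apply']
    exact hjoint.comp (ih.prodMk measurable_id)

variable {Ω : Type*} [MeasurableSpace Ω] {P : Measure Ω} [IsProbabilityMeasure P]

/-- An estimating function regular at `θ₀` has measurable zeros, with probability tending to one,
that are consistent for `θ₀`. -/
theorem exists_measurable_zero (h : RegularEstimatingFunction Q ψ A M J θ₀ r₀)
    {G : E →L[ℝ] E} (hGJ : G ∘L J = .id ℝ E) (hJG : J ∘L G = .id ℝ E)
    {X : ℕ → Ω → 𝓧} (hindep : iIndepFun X P) (hlaw : ∀ i, HasLaw (X i) Q P) :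
    ∃ T : (n : ℕ) → (Fin n → 𝓧) → E, (∀ n, Measurable (T n)) ∧
      Tendsto (fun n : ℕ => P {w | ¬ (T n (fun i => X i w) ∈ Metric.closedBall θ₀ r₀ ∧
        sampleMean (ψ (T n fun i => X i w)) (fun i : Fin n => X i w) = 0)}) atTop (𝓝 0) ∧
      TendstoInMeasure P (fun n w => T n fun i => X i w) atTop fun _ => θ₀ := by
  have : CompleteSpace E := FiniteDimensional.complete ℝ E
  have hA₀ := tendstoInMeasure_sample_mean (h := A) hindep hlaw h.integrable_deriv
  have hA := tendstoInMeasure_iff_norm.1 hA₀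
  have hM₀ := tendstoInMeasure_sample_mean (h := M) hindep hlaw h.integrable_bound
  have hM := tendstoInMeasure_iff_norm.1 hM₀
  have hψ₀ := tendstoInMeasure_sample_mean (h := ψ θ₀) hindep hlaw h.integrable
  have hψ := tendstoInMeasure_iff_norm.1 hψ₀
  simp only [h.integral_deriv, h.integral_eq_zero, sub_zero, sub_neg_eq_add] at hA hψ
  have hm : 0 ≤ ∫ x, M x ∂Q := integral_nonneg h.bound_nonneg
  set m := ∫ x, M x ∂Q
  have hC : 0 < ‖G‖ + 1 := by positivity
  -- The contraction constant 1/2 is split into 1/4 for the remainder and 1/4 for the deviation of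
  -- the mean Jacobian from -J. Using ‖G‖ + 1 avoids division by zero, and m + 1 bounds the sample
  -- mean of M off the exceptional event.
  obtain ⟨r, hr, hrr, hrm⟩ : ∃ r, 0 < r ∧ r ≤ r₀ ∧ (‖G‖ + 1) * ((m + 1) * r) ≤ 1 / 4 := by
    refine ⟨min r₀ (1 / (4 * (‖G‖ + 1) * (m + 1))), lt_min h.pos (by positivity),
      min_le_left _ _, ?_⟩
    calc _ ≤ (‖G‖ + 1) * ((m + 1) * (1 / (4 * (‖G‖ + 1) * (m + 1)))) := by
          gcongr; exact min_le_right _ _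
      _ = 1 / 4 := by field_simp
  -- `limUnder` takes an arbitrary value where the iterates diverge, which can happen only for
  -- samples in `bad`.
  let T : (n : ℕ) → (Fin n → 𝓧) → E := fun n x =>
    limUnder atTop fun k => (newtonStep G (fun θ => sampleMean (ψ θ) x) θ₀ r)^[k] θ₀
  let bad : ℕ → Set Ω := fun n =>
    ({w | 1 / (4 * (‖G‖ + 1)) ≤ ‖(n : ℝ)⁻¹ • ∑ i : Fin n, A (X i w) + J‖} ∪
      {w | 1 ≤ ‖(n : ℝ)⁻¹ • ∑ i : Fin n, M (X i w) - m‖}) ∪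
      {w | r / (2 * (‖G‖ + 1)) ≤ ‖(n : ℝ)⁻¹ • ∑ i : Fin n, ψ θ₀ (X i w)‖}
  have hbad : Tendsto (fun n => P (bad n)) atTop (𝓝 0) :=
    tendsto_measure_zero_of_subset_union (tendsto_measure_zero_of_subset_union
      (hA _ (by positivity)) (hM 1 one_pos) fun _ => subset_rfl) (hψ _ (by positivity))
      fun _ => subset_rfl
  have hgood : ∀ n, ∀ w ∉ bad n, T n (fun i => X i w) ∈ Metric.closedBall θ₀ r ∧
      sampleMean (ψ (T n fun i => X i w)) (fun i : Fin n => X i w) = 0 ∧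
      ‖T n (fun i => X i w) - θ₀‖ ≤
        2 * ((‖G‖ + 1) * ‖(n : ℝ)⁻¹ • ∑ i : Fin n, ψ θ₀ (X i w)‖) := by
    intro n w hw
    simp only [bad, Set.mem_union, Set.mem_ofPred_eq, not_or, not_le] at hw
    obtain ⟨⟨hw1, hw2⟩, hw3⟩ := hw
    have hGψ : ‖G (sampleMean (ψ θ₀) fun i : Fin n => X i w)‖
        ≤ (‖G‖ + 1) * ‖(n : ℝ)⁻¹ • ∑ i : Fin n, ψ θ₀ (X i w)‖ :=
      (G.le_opNorm _).trans (mul_le_mul_of_nonneg_right (by linarith) (norm_nonneg _))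
    have hMle : sampleMean M (fun i : Fin n => X i w) ≤ m + 1 := by
      have := (abs_lt.1 hw2).2
      simp only [sampleMean]
      linarith
    obtain ⟨y, hy, hy0, hyle, hytend⟩ := exists_zero_tendsto_newtonStep (G := G) (J := J)
      (A := sampleMean A fun i : Fin n => X i w) (F := fun θ => sampleMean (ψ θ) fun i : Fin n => X i w)
      (θ₀ := θ₀) (m := sampleMean M fun i : Fin n => X i w) hr hGJ hJG
      (fun θ hθ θ' hθ' => h.sampleMean_linearization _ hrr hθ hθ') (by
        calc _ ≤ (‖G‖ + 1) * (1 / (4 * (‖G‖ + 1)) + (m + 1) * r) := by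
              refine mul_le_mul (by linarith) (add_le_add hw1.le
                (mul_le_mul_of_nonneg_right hMle hr.le)) ?_ hC.le
              exact add_nonneg (norm_nonneg _) (mul_nonneg (smul_nonneg (by positivity)
                (Finset.sum_nonneg fun i _ => h.bound_nonneg _)) hr.le)
          _ ≤ 1 / 4 + 1 / 4 := by
              rw [mul_add]
              refine add_le_add (le_of_eq ?_) hrm
              field_simp
          _ = 1 / 2 := by norm_num) (hGψ.trans (by
        calc _ ≤ (‖G‖ + 1) * (r / (2 * (‖G‖ + 1))) := by have := hw3.le; gcongr
          _ = r / 2 := by field_simp))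
    have hT : T n (fun i => X i w) = y := hytend.limUnder_eq
    rw [hT]
    exact ⟨hy, hy0, hyle.trans (by linarith)⟩
  refine ⟨T, fun n => ?_, ?_, ?_⟩
  · have : ProperSpace E := FiniteDimensional.proper ℝ E
    exact (StronglyMeasurable.limUnder fun k =>
      (h.measurable_newtonStep_iterate G hr hrr n k).stronglyMeasurable).measurable
  · refine tendsto_measure_zero_of_subset_union hbad hbad fun n w hw => ?_
    by_contra hwb
    have := hgood n w fun hb => hwb (Or.inl hb)
    exact hw ⟨Metric.closedBall_subset_closedBall hrr this.1, this.2.1⟩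
  · rw [tendstoInMeasure_iff_norm]
    intro ε hε
    -- The radius `r` does not shrink. Consistency comes from the bound of the root's error by the
    -- sample mean of ψ at θ₀.
    refine tendsto_measure_zero_of_subset_union hbad (hψ (ε / (2 * (‖G‖ + 1))) (by positivity))
      fun n w hw => ?_
    by_cases hwb : w ∈ bad n
    · exact Or.inl hwb
    · refine Or.inr ?_
      have := hw.trans (hgood n w hwb).2.2
      rw [Set.mem_ofPred_eq, div_le_iff₀ (by positivity)]
      linarith

/-- Consistent zeros of a regular estimating function are asymptotically linear, hence have the
limit distribution of the normalized sum of the influence functions. -/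
theorem tendstoInDistribution (h : RegularEstimatingFunction Q ψ A M J θ₀ r₀)
    {G : E →L[ℝ] E} (hGJ : G ∘L J = .id ℝ E)
    {X : ℕ → Ω → 𝓧} (hindep : iIndepFun X P) (hlaw : ∀ i, HasLaw (X i) Q P)
    {Ω' : Type*} [MeasurableSpace Ω'] {P' : Measure Ω'} [IsProbabilityMeasure P'] {Z : Ω' → E}
    (hZ : TendstoInDistribution
      (fun (n : ℕ) w => (√n)⁻¹ • ∑ k ∈ Finset.range n, G (ψ θ₀ (X k w))) atTop Z (fun _ => P) P')
    {θhat : ℕ → Ω → E} (hmeas : ∀ n, AEMeasurable (θhat n) P)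
    (hzero : Tendsto (fun n : ℕ =>
      P {w | sampleMean (ψ (θhat n w)) (fun i : Fin n => X i w) ≠ 0}) atTop (𝓝 0))
    (hcons : TendstoInMeasure P θhat atTop fun _ => θ₀) :
    TendstoInDistribution (fun (n : ℕ) w => √n • (θhat n w - θ₀)) atTop Z (fun _ => P) P' := by
  have : ProperSpace E := FiniteDimensional.proper ℝ E
  have hA₀ := tendstoInMeasure_sample_mean (h := A) hindep hlaw h.integrable_deriv
  have hA := tendstoInMeasure_iff_norm.1 hA₀
  have hM₀ := tendstoInMeasure_sample_mean (h := M) hindep hlaw h.integrable_bound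
  have hM := tendstoInMeasure_iff_norm.1 hM₀
  simp only [h.integral_deriv, sub_neg_eq_add] at hA
  have hm : 0 ≤ ∫ x, M x ∂Q := integral_nonneg h.bound_nonneg
  set m := ∫ x, M x ∂Q
  rw [tendstoInMeasure_iff_norm] at hcons
  -- The factor in `norm_sub_newton_le_of_zero` with radius ‖θhat - θ₀‖ and the sample mean of M
  -- replaced by its upper bound m + 1.
  let η : ℕ → Ω → ℝ := fun n w =>
    ‖G‖ * (‖(n : ℝ)⁻¹ • ∑ i : Fin n, A (X i w) + J‖ + (m + 1) * ‖θhat n w - θ₀‖)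
  have hη0 : ∀ n w, 0 ≤ η n w := fun n w => by positivity
  have hηmeas : ∀ n, AEMeasurable (η n) P := fun n => by
    have h1 : AEMeasurable (fun w => ∑ i : Fin n, A (X i w)) P :=
      Finset.aemeasurable_fun_sum _ fun i _ =>
        (identDistrib_comp_of_hasLaw hlaw h.integrable_deriv.aemeasurable i).aemeasurable_fst
    have h2 := ((h1.const_smul (n : ℝ)⁻¹).add_const J).norm
    exact (h2.add (((hmeas n).sub_const θ₀).norm.const_mul (m + 1))).const_mul ‖G‖
  have hη : TendstoInMeasure P η atTop fun _ => (0 : ℝ) := by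
    rw [tendstoInMeasure_iff_norm]
    intro ε hε
    refine tendsto_measure_zero_of_subset_union
      (hA (ε / (2 * (‖G‖ + 1))) (by positivity))
      (hcons (ε / (2 * (‖G‖ + 1) * (m + 1))) (by positivity)) fun n w hw => ?_
    by_contra hcon
    simp only [Set.mem_union, Set.mem_ofPred_eq, not_or, not_le] at hcon
    rw [Set.mem_ofPred_eq, sub_zero, Real.norm_of_nonneg (hη0 n w)] at hw
    have h1 : (‖G‖ + 1) * (‖(n : ℝ)⁻¹ • ∑ i : Fin n, A (X i w) + J‖
        + (m + 1) * ‖θhat n w - θ₀‖) < (‖G‖ + 1) * (ε / (2 * (‖G‖ + 1))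
        + (m + 1) * (ε / (2 * (‖G‖ + 1) * (m + 1)))) := by
      have := hcon.1
      have := hcon.2
      gcongr
    have h2 : (‖G‖ + 1) * (ε / (2 * (‖G‖ + 1)) + (m + 1) * (ε / (2 * (‖G‖ + 1) * (m + 1)))) = ε := by
      field_simp; ring
    have h3 : η n w ≤ (‖G‖ + 1) * (‖(n : ℝ)⁻¹ • ∑ i : Fin n, A (X i w) + J‖
        + (m + 1) * ‖θhat n w - θ₀‖) := by
      refine mul_le_mul_of_nonneg_right (by linarith) (by positivity)
    linarith
  -- Slutsky: η tends to zero in probability and the normalized sum converges in distribution, so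
  -- their product tends to zero in probability.
  have hprod := tendstoInMeasure_iff_norm.1 (tendstoInMeasure_of_tendstoInDistribution_const
    (c := (0 : E)) (by
      simpa using hZ.continuous_comp_prodMk_of_tendstoInMeasure_const
        (g := fun q : E × ℝ => q.2 • q.1) (by fun_prop) hη hηmeas))
  simp only [sub_zero] at hprod
  rw [tendstoInMeasure_iff_norm] at hη
  simp only [sub_zero] at hη
  refine tendstoInDistribution_of_tendstoInMeasure_sub _ _ hZ ?_
    fun n => ((hmeas n).sub_const θ₀).const_smul (√n : ℝ)
  rw [tendstoInMeasure_iff_norm]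
  intro ε hε
  let bad : ℕ → Set Ω := fun n =>
    (({w | sampleMean (ψ (θhat n w)) (fun i : Fin n => X i w) ≠ 0} ∪ {w | r₀ ≤ ‖θhat n w - θ₀‖}) ∪
      {w | 1 ≤ ‖(n : ℝ)⁻¹ • ∑ i : Fin n, M (X i w) - m‖}) ∪ {w | 1 / 2 ≤ ‖η n w‖}
  have hbad : Tendsto (fun n => P (bad n)) atTop (𝓝 0) :=
    tendsto_measure_zero_of_subset_union (tendsto_measure_zero_of_subset_union
      (tendsto_measure_zero_of_subset_union hzero (hcons r₀ h.pos) fun _ => subset_rfl)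
      (hM 1 one_pos) fun _ => subset_rfl) (hη _ (by norm_num)) fun _ => subset_rfl
  -- The threshold ε / 2 pays for the factor 2 in the bound of `δ` by `v`.
  refine tendsto_measure_zero_of_subset_union hbad (hprod (ε / 2) (by positivity)) fun n w hw => ?_
  by_cases hwb : w ∈ bad n
  · exact Or.inl hwb
  refine Or.inr ?_
  simp only [bad, Set.mem_union, Set.mem_ofPred_eq, not_or, not_le, not_not] at hwb
  obtain ⟨⟨⟨hw1, hw2⟩, hw3⟩, hw4⟩ := hwb
  rw [Real.norm_of_nonneg (hη0 n w)] at hw4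
  have hMle : sampleMean M (fun i : Fin n => X i w) ≤ m + 1 := by
    have := (abs_lt.1 hw3).2
    simp only [sampleMean]
    linarith
  have hlin := h.sampleMean_linearization (fun i : Fin n => X i w) hw2.le
    (θ := θhat n w) (θ' := θ₀) (by simp [dist_eq_norm]) (by simp)
  have hnewton := norm_sub_newton_le_of_zero hGJ
    (F := fun θ => sampleMean (ψ θ) (fun i : Fin n => X i w)) hlin hw1
  set δ := θhat n w - θ₀ with hδ
  set v := G (sampleMean (ψ θ₀) (fun i : Fin n => X i w)) with hv
  have hδv : ‖δ - v‖ ≤ η n w * ‖δ‖ := by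
    refine hnewton.trans (mul_le_mul_of_nonneg_right ?_ (norm_nonneg _))
    refine mul_le_mul_of_nonneg_left (add_le_add le_rfl ?_) (norm_nonneg _)
    exact mul_le_mul_of_nonneg_right hMle (norm_nonneg _)
  -- Absorbing the error with η < 1/2 bounds δ by `v`, so tightness of √n δ need not be proved
  -- separately.
  have hδ2 : ‖δ‖ ≤ 2 * ‖v‖ := by
    have h1 : ‖δ‖ ≤ ‖δ - v‖ + ‖v‖ := by simpa using norm_add_le (δ - v) v
    have h2 : η n w * ‖δ‖ ≤ 1 / 2 * ‖δ‖ := mul_le_mul_of_nonneg_right hw4.le (norm_nonneg _)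
    linarith
  have hW : (√n)⁻¹ • ∑ k ∈ Finset.range n, G (ψ θ₀ (X k w)) = (√n : ℝ) • v := by
    rw [hv, sampleMean, map_smul, map_sum, smul_smul, ← div_eq_mul_inv, Real.sqrt_div_self',
      one_div, Finset.sum_range]
  simp only [Set.mem_ofPred_eq, Pi.sub_apply, Pi.zero_apply, sub_zero] at hw
  rw [hW, ← smul_sub, norm_smul, Real.norm_of_nonneg (Real.sqrt_nonneg _)] at hw
  rw [Set.mem_ofPred_eq, hW, norm_smul, norm_smul, Real.norm_of_nonneg (Real.sqrt_nonneg _),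
    Real.norm_of_nonneg (hη0 n w)]
  have h1 : ‖δ - v‖ ≤ η n w * (2 * ‖v‖) := hδv.trans (mul_le_mul_of_nonneg_left hδ2 (hη0 n w))
  have h2 := hw.trans (mul_le_mul_of_nonneg_left h1 (Real.sqrt_nonneg n))
  linarith

end RegularEstimatingFunction

end EstimatingFunction

/-! ### Partial derivatives and first-order expansion -/

section Calculus

variable {p : ℕ}

local notation "𝔼" => EuclideanSpace ℝ (Fin p)

lemma euclidean_eq_sum_single (v : 𝔼) : v = ∑ k, v k • EuclideanSpace.single k (1 : ℝ) := by
  have := (EuclideanSpace.basisFun (Fin p) ℝ).sum_repr v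
  simpa using this.symm

lemma norm_le_sum_abs (v : 𝔼) : ‖v‖ ≤ ∑ j, |v j| := by
  conv_lhs => rw [euclidean_eq_sum_single v]
  refine (norm_sum_le _ _).trans (le_of_eq ?_)
  simp [norm_smul]

lemma opNorm_le_sum_norm_single {F : Type*} [NormedAddCommGroup F] [NormedSpace ℝ F]
    (L : 𝔼 →L[ℝ] F) : ‖L‖ ≤ ∑ k, ‖L (EuclideanSpace.single k 1)‖ := by
  refine L.opNorm_le_bound (Finset.sum_nonneg fun _ _ => norm_nonneg _) fun v => ?_
  conv_lhs => rw [euclidean_eq_sum_single v]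
  rw [map_sum, Finset.sum_mul]
  refine (norm_sum_le _ _).trans (Finset.sum_le_sum fun k _ => ?_)
  rw [map_smul, norm_smul, mul_comm]
  exact mul_le_mul_of_nonneg_left (PiLp.norm_apply_le v k) (norm_nonneg _)

lemma partialDeriv_congr {F F' : 𝔼 → ℝ} {θ : 𝔼} (h : F =ᶠ[𝓝 θ] F') (k : Fin p) :
    partialDeriv k F θ = partialDeriv k F' θ := by
  rw [partialDeriv, partialDeriv, h.fderiv_eq]

lemma partialDeriv_sub {F F' : 𝔼 → ℝ} {θ : 𝔼} (hF : DifferentiableAt ℝ F θ)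
    (hF' : DifferentiableAt ℝ F' θ) (k : Fin p) :
    partialDeriv k (fun t => F t - F' t) θ = partialDeriv k F θ - partialDeriv k F' θ := by
  simp [partialDeriv, fderiv_fun_sub hF hF']

lemma partialDeriv_mul {F F' : 𝔼 → ℝ} {θ : 𝔼} (hF : DifferentiableAt ℝ F θ)
    (hF' : DifferentiableAt ℝ F' θ) (k : Fin p) :
    partialDeriv k (fun t => F t * F' t) θ
      = F θ * partialDeriv k F' θ + F' θ * partialDeriv k F θ := by
  simp [partialDeriv, fderiv_fun_mul hF hF']

lemma fderiv_euclidean_apply {F : 𝔼 → 𝔼} {θ : 𝔼} (hF : DifferentiableAt ℝ F θ) (v : 𝔼)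
    (j : Fin p) : fderiv ℝ F θ v j = fderiv ℝ (fun t => F t j) θ v := by
  have h : HasFDerivAt (fun t => F t j) ((EuclideanSpace.proj j : 𝔼 →L[ℝ] ℝ) ∘L fderiv ℝ F θ) θ :=
    (EuclideanSpace.proj j : 𝔼 →L[ℝ] ℝ).hasFDerivAt.comp θ hF.hasFDerivAt
  rw [h.fderiv]
  simp

/-- First-order expansion at the centre of a ball with a Lipschitz remainder, for a map whose
second partial derivatives are bounded. -/
lemma norm_sub_sub_fderiv_le {F : 𝔼 → 𝔼} {ω : Set 𝔼} {M : Fin p → Fin p → Fin p → ℝ}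
    {θ₀ : 𝔼} {ρ : ℝ} (hball : Metric.closedBall θ₀ ρ ⊆ ω)
    (hF : ∀ θ ∈ ω, ∀ j, DifferentiableAt ℝ (fun t => F t j) θ)
    (hF' : ∀ θ ∈ ω, ∀ j l, DifferentiableAt ℝ (partialDeriv l fun t => F t j) θ)
    (hM : ∀ θ ∈ ω, ∀ j k l, |partialDeriv k (partialDeriv l fun t => F t j) θ| ≤ M j k l)
    {θ θ' : 𝔼} (hθ : θ ∈ Metric.closedBall θ₀ ρ) (hθ' : θ' ∈ Metric.closedBall θ₀ ρ) :
    ‖F θ - F θ' - fderiv ℝ F θ₀ (θ - θ')‖ ≤ (∑ j, ∑ l, ∑ k, M j k l) * ρ * ‖θ - θ'‖ := by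
  have hρ : 0 ≤ ρ := dist_nonneg.trans hθ
  have hθ₀ : θ₀ ∈ Metric.closedBall θ₀ ρ := Metric.mem_closedBall_self hρ
  have hcvx := convex_closedBall θ₀ ρ
  have hFd : DifferentiableAt ℝ F θ₀ := differentiableAt_euclidean.2 (hF θ₀ (hball hθ₀))
  -- The mean value inequality is used twice: here on the first partials, and in `h3` on each
  -- component minus its derivative at the centre.
  have h1 : ∀ j l, ∀ t ∈ Metric.closedBall θ₀ ρ,
      ‖partialDeriv l (fun t => F t j) t - partialDeriv l (fun t => F t j) θ₀‖
        ≤ (∑ k, M j k l) * ρ := fun j l t ht => by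
    refine (hcvx.norm_image_sub_le_of_norm_fderiv_le (fun s hs => hF' s (hball hs) j l)
      (fun s hs => (opNorm_le_sum_norm_single _).trans
        (Finset.sum_le_sum fun k _ => hM s (hball hs) j k l)) hθ₀ ht).trans ?_
    refine mul_le_mul_of_nonneg_left (mem_closedBall_iff_norm.1 ht) ?_
    exact Finset.sum_nonneg fun k _ => (abs_nonneg _).trans (hM θ₀ (hball hθ₀) j k l)
  have h2 : ∀ j, ∀ t ∈ Metric.closedBall θ₀ ρ,
      ‖fderiv ℝ (fun t => F t j) t - fderiv ℝ (fun t => F t j) θ₀‖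
        ≤ (∑ l, ∑ k, M j k l) * ρ := fun j t ht => by
    rw [Finset.sum_mul]
    exact (opNorm_le_sum_norm_single _).trans (Finset.sum_le_sum fun l _ => h1 j l t ht)
  refine (norm_le_sum_abs _).trans ?_
  rw [Finset.sum_mul, Finset.sum_mul]
  refine Finset.sum_le_sum fun j _ => ?_
  have h3 := hcvx.norm_image_sub_le_of_norm_fderiv_le' (fun t ht => hF t (hball ht) j) (h2 j)
    hθ' hθ
  simpa [fderiv_euclidean_apply hFd] using h3

end Calculus

/-! ### Derivatives of the weighted score -/

section Score

variable {p : ℕ} {𝓧 : Type*}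
  {f : EuclideanSpace ℝ (Fin p) → 𝓧 → ℝ} {θ : EuclideanSpace ℝ (Fin p)} {x : 𝓧}
  {ω : Set (EuclideanSpace ℝ (Fin p))}

local notation "𝔼" => EuclideanSpace ℝ (Fin p)

lemma score_apply (f : 𝔼 → 𝓧 → ℝ) (θ : 𝔼) (x : 𝓧) (j : Fin p) :
    score f θ x j = partialDeriv j (fun t => Real.log (f t x)) θ := by
  have h := InnerProductSpace.toDual_symm_apply (𝕜 := ℝ) (x := EuclideanSpace.single j (1 : ℝ))
    (y := fderiv ℝ (fun t => Real.log (f t x)) θ)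
  rw [EuclideanSpace.inner_single_right] at h
  rw [partialDeriv, ← h, score, gradient]
  simp

lemma weightedScore_apply (f : 𝔼 → 𝓧 → ℝ) (a b : ℝ) (θ : 𝔼) (x : 𝓧) (j : Fin p) :
    weightedScore f a b θ x j = weight f a b θ x * score f θ x j := by
  simp [weightedScore]

lemma contDiffOn_partialDeriv (hω : IsOpen ω)
    {F : 𝔼 → ℝ} {m n : WithTop ℕ∞} (hF : ContDiffOn ℝ n F ω)
    (hmn : m + 1 ≤ n) (k : Fin p) : ContDiffOn ℝ m (partialDeriv k F) ω :=
  (hF.fderiv_of_isOpen hω hmn).clm_apply contDiffOn_const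

lemma contDiffOn_score (hω : IsOpen ω) (hpos : ∀ θ ∈ ω, 0 < f θ x)
    (hsmooth : ContDiffOn ℝ 3 (fun θ => f θ x) ω)
    (j : Fin p) : ContDiffOn ℝ 2 (fun t => score f t x j) ω := by
  simp only [score_apply]
  exact contDiffOn_partialDeriv hω (hsmooth.log fun θ hθ => (hpos θ hθ).ne') (by norm_num) j

lemma contDiffOn_weight (hpos : ∀ θ ∈ ω, 0 < f θ x) (hsmooth : ContDiffOn ℝ 3 (fun θ => f θ x) ω)
    (a b : ℝ) : ContDiffOn ℝ 3 (fun t => weight f a b t x) ω :=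
  (hsmooth.rpow_const_of_ne fun θ hθ => (hpos θ hθ).ne').mul (contDiffOn_const.mul hsmooth).exp

lemma contDiffOn_weightedScore (hω : IsOpen ω) (hpos : ∀ θ ∈ ω, 0 < f θ x)
    (hsmooth : ContDiffOn ℝ 3 (fun θ => f θ x) ω)
    (a b : ℝ) (j : Fin p) :
    ContDiffOn ℝ 2 (fun t => weightedScore f a b t x j) ω := by
  simp only [weightedScore_apply]
  exact ((contDiffOn_weight hpos hsmooth a b).of_le (by norm_num)).mul
    (contDiffOn_score hω hpos hsmooth j)

lemma partialDeriv_density (hω : IsOpen ω) (hpos : ∀ θ ∈ ω, 0 < f θ x)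
    (hsmooth : ContDiffOn ℝ 3 (fun θ => f θ x) ω)
    (hθ : θ ∈ ω) (k : Fin p) :
    partialDeriv k (fun t => f t x) θ = f θ x * score f θ x k := by
  have hd := (hsmooth.contDiffAt (hω.mem_nhds hθ)).differentiableAt (by norm_num)
  rw [score_apply, partialDeriv, partialDeriv, fderiv.log hd (hpos θ hθ).ne']
  simp [mul_inv_cancel_left₀ (hpos θ hθ).ne']

lemma partialDeriv_weight (hω : IsOpen ω) (hpos : ∀ θ ∈ ω, 0 < f θ x)
    (hsmooth : ContDiffOn ℝ 3 (fun θ => f θ x) ω)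
    (a b : ℝ) (hθ : θ ∈ ω) (k : Fin p) :
    partialDeriv k (fun t => weight f a b t x) θ
      = weight f a b θ x * (b * score f θ x k + a * score f θ x k * f θ x) := by
  have hd := (hsmooth.contDiffAt (hω.mem_nhds hθ)).differentiableAt (by norm_num)
  have hp := hpos θ hθ
  have h1 : HasFDerivAt (fun t => f t x ^ b) _ θ := hd.hasFDerivAt.rpow_const (Or.inl hp.ne')
  have h2 : HasFDerivAt (fun t => Real.exp (a * f t x)) _ θ := (hd.hasFDerivAt.const_mul a).exp
  have h3 := partialDeriv_density hω hpos hsmooth hθ k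
  unfold weight
  rw [partialDeriv_mul h1.differentiableAt h2.differentiableAt, partialDeriv, partialDeriv,
    h1.fderiv, h2.fderiv]
  rw [partialDeriv] at h3
  simp only [_root_.smul_apply, smul_eq_mul, h3, Real.rpow_sub_one hp.ne']
  field_simp
  ring

lemma partialDeriv_weightedScore (hω : IsOpen ω) (hpos : ∀ θ ∈ ω, 0 < f θ x)
    (hsmooth : ContDiffOn ℝ 3 (fun θ => f θ x) ω)
    (a b : ℝ) (hθ : θ ∈ ω) (j k : Fin p) :
    partialDeriv k (fun t => weightedScore f a b t x j) θ
      = weight f a b θ x * (b * (score f θ x j * score f θ x k)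
        + a * (score f θ x j * score f θ x k) * f θ x - info f θ x j k) := by
  have h1 := ((contDiffOn_weight hpos hsmooth a b).contDiffAt (hω.mem_nhds hθ)).differentiableAt
    (by norm_num)
  have h2 := ((contDiffOn_score hω hpos hsmooth j).contDiffAt (hω.mem_nhds hθ)).differentiableAt
    (by norm_num)
  simp only [weightedScore_apply]
  rw [partialDeriv_mul h1 h2, partialDeriv_weight hω hpos hsmooth a b hθ, info]
  ring

lemma weight_one_add (hpos : ∀ θ ∈ ω, 0 < f θ x)
    (a b : ℝ) (hθ : θ ∈ ω) :
    weight f a (1 + b) θ x = f θ x * weight f a b θ x := by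
  rw [weight, weight, Real.rpow_add (hpos θ hθ), Real.rpow_one, mul_assoc]

/-- Since the weight with exponent 1 + b is f times the one with exponent b, the two derivatives
combine with the common factor g - f. The extra 1 in the exponent leaves the u uᵀ term of the first
integral in J. -/
lemma jacobian_integrand_eq (hω : IsOpen ω) (hpos : ∀ θ ∈ ω, 0 < f θ x)
    (hsmooth : ContDiffOn ℝ 3 (fun θ => f θ x) ω)
    (g : 𝓧 → ℝ) (a b : ℝ) (hθ : θ ∈ ω) (j k : Fin p) :
    g x * partialDeriv k (fun t => weightedScore f a b t x j) θ
        - partialDeriv k (fun t => weightedScore f a (1 + b) t x j) θ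
      = -(score f θ x j * score f θ x k * weight f a (1 + b) θ x
        + jRemainder f g a b θ j k x) := by
  rw [partialDeriv_weightedScore hω hpos hsmooth a b hθ,
    partialDeriv_weightedScore hω hpos hsmooth a (1 + b) hθ, weight_one_add hpos a b hθ,
    jRemainder]
  ring

/-- With the convention log 0 = 0, the log-density is constant near θ. -/
lemma score_eq_zero (hω : IsOpen ω) (hzero : ∀ θ ∈ ω, f θ x = 0)
    (hθ : θ ∈ ω) : score f θ x = 0 := by
  have h : (fun t => Real.log (f t x)) =ᶠ[𝓝 θ] fun _ => 0 :=
    (hω.eventually_mem hθ).mono fun t ht => by simp [hzero t ht]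
  ext j
  rw [score_apply, partialDeriv_congr h]
  simp [partialDeriv]

lemma partialDeriv_weightedScore_eq_zero (hω : IsOpen ω) (hzero : ∀ θ ∈ ω, f θ x = 0)
    (a b : ℝ) (hθ : θ ∈ ω) (j k : Fin p) :
    partialDeriv k (fun t => weightedScore f a b t x j) θ = 0 := by
  have h : (fun t => weightedScore f a b t x j) =ᶠ[𝓝 θ] fun _ => 0 :=
    (hω.eventually_mem hθ).mono fun t ht => by
      simp [weightedScore_apply, score_eq_zero hω hzero ht]
  rw [partialDeriv_congr h]
  simp [partialDeriv]

lemma jRemainder_eq_zero (hω : IsOpen ω) (hzero : ∀ θ ∈ ω, f θ x = 0)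
    (g : 𝓧 → ℝ) (a b : ℝ) (hθ : θ ∈ ω) (j k : Fin p) :
    jRemainder f g a b θ j k x = 0 := by
  have h : (fun t => score f t x j) =ᶠ[𝓝 θ] fun _ => 0 :=
    (hω.eventually_mem hθ).mono fun t ht => by simp [score_eq_zero hω hzero ht]
  rw [jRemainder, info, partialDeriv_congr h, score_eq_zero hω hzero hθ]
  simp [partialDeriv]

lemma weight_sq {a b : ℝ} (hf : 0 ≤ f θ x) :
    weight f a b θ x * weight f a b θ x = weight f (2 * a) (2 * b) θ x := by
  have h1 : f θ x ^ (2 * b) = f θ x ^ b * f θ x ^ b := by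
    rw [mul_comm, Real.rpow_mul hf, Real.rpow_two, sq]
  have h2 : Real.exp (2 * a * f θ x) = Real.exp (a * f θ x) * Real.exp (a * f θ x) := by
    rw [← Real.exp_add]; ring_nf
  rw [weight, weight, h1, h2]
  ring

end Score

/-! ### Integration against the true distribution -/

section Distribution

variable {𝓧 : Type*} [MeasurableSpace 𝓧] {μ : Measure 𝓧} {g : 𝓧 → ℝ}
  {F : Type*} [NormedAddCommGroup F] [NormedSpace ℝ F]

lemma integral_distribution (hg : IsDensity μ g) (h : 𝓧 → F) :
    ∫ x, h x ∂(distribution μ g) = ∫ x, g x • h x ∂μ := by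
  rw [distribution, integral_withDensity_eq_integral_toReal_smul hg.measurable.ennreal_ofReal
    (by simp)]
  simp [ENNReal.toReal_ofReal (hg.nonneg _)]

lemma integrable_distribution_iff (hg : IsDensity μ g) {h : 𝓧 → F} :
    Integrable h (distribution μ g) ↔ Integrable (fun x => g x • h x) μ := by
  rw [distribution, integrable_withDensity_iff_integrable_smul' hg.measurable.ennreal_ofReal
    (by simp)]
  simp [ENNReal.toReal_ofReal (hg.nonneg _)]

lemma ae_distribution_iff (hg : IsDensity μ g) {q : 𝓧 → Prop} :
    (∀ᵐ x ∂(distribution μ g), q x) ↔ ∀ᵐ x ∂μ, 0 < g x → q x := by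
  rw [distribution, ae_withDensity_iff hg.measurable.ennreal_ofReal]
  simp

end Distribution

/-- The standing assumptions on the model, the true density and the best-fitting parameter. -/
structure RegularModel {p : ℕ} {𝓧 : Type*} [MeasurableSpace 𝓧] (μ : Measure 𝓧)
    (Θ ω : Set (EuclideanSpace ℝ (Fin p))) (S : Set 𝓧) (f : EuclideanSpace ℝ (Fin p) → 𝓧 → ℝ)
    (g : 𝓧 → ℝ) (α β : ℝ) (θ₀ : EuclideanSpace ℝ (Fin p)) : Prop where
  isDensity_model : ∀ θ ∈ Θ, IsDensity μ (f θ)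
  isDensity : IsDensity μ g
  isOpen : IsOpen ω
  subset : ω ⊆ Θ
  mem : θ₀ ∈ ω
  isBestFitting : IsBestFitting μ f g α β θ₀
  kExists : KExists μ f g α β θ₀
  condD1 : CondD1 μ f g Θ S
  condD2 : CondD2 μ f ω S
  condD3 : CondD3 μ f g α β ω
  condD4 : CondD4 μ f g α β θ₀
  condD5 : CondD5 μ f g α β ω S

/-! ### Moments and derivatives of V under the model assumptions -/

namespace RegularModel

variable {p : ℕ} {𝓧 : Type*} [MeasurableSpace 𝓧] {μ : Measure 𝓧}
  {Θ ω : Set (EuclideanSpace ℝ (Fin p))} {S : Set 𝓧} {f : EuclideanSpace ℝ (Fin p) → 𝓧 → ℝ}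
  {g : 𝓧 → ℝ} {α β : ℝ} {θ₀ θ : EuclideanSpace ℝ (Fin p)} {x : 𝓧}

lemma pos (h : RegularModel μ Θ ω S f g α β θ₀) (hx : x ∈ S) : ∀ θ ∈ ω, 0 < f θ x := fun θ hθ => by
  rw [← h.condD1.1 θ (h.subset hθ)] at hx
  exact hx

lemma eq_zero (h : RegularModel μ Θ ω S f g α β θ₀) (hx : x ∉ S) : ∀ θ ∈ ω, f θ x = 0 :=
  fun θ hθ => by
    rw [← h.condD1.1 θ (h.subset hθ)] at hx
    exact le_antisymm (not_lt.1 hx) ((h.isDensity_model θ (h.subset hθ)).nonneg x)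

lemma ae_density_eq_zero (h : RegularModel μ Θ ω S f g α β θ₀) : ∀ᵐ x ∂μ, x ∉ S → g x = 0 := by
  filter_upwards [h.condD1.2] with x hx hxS
  exact le_antisymm (not_lt.1 fun hg => hxS (hx.1 hg)) (h.isDensity.nonneg x)

/-- The density is smooth in the parameter, and the second derivatives of the estimating function
are dominated, on a measurable set of full measure under the true distribution. -/
lemma exists_measurable_regular (h : RegularModel μ Θ ω S f g α β θ₀) :
    ∃ (G : Set 𝓧) (M : 𝓧 → Fin p → Fin p → Fin p → ℝ), MeasurableSet G ∧
      (∀ᵐ x ∂(distribution μ g), x ∈ G) ∧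
      (∀ j k l, Integrable (fun x => M x j k l) (distribution μ g)) ∧
      ∀ x ∈ G, x ∈ S ∧ ContDiffOn ℝ 3 (fun θ => f θ x) ω ∧ ∀ θ ∈ ω, ∀ j k l,
        |partialDeriv k (partialDeriv l fun t => V μ f α β t x j) θ| ≤ M x j k l := by
  obtain ⟨M, hM, hbound⟩ := h.condD5
  have hae : ∀ᵐ x ∂(distribution μ g), x ∈ S ∧ ContDiffOn ℝ 3 (fun θ => f θ x) ω ∧
      ∀ θ ∈ ω, ∀ j k l,
        |partialDeriv k (partialDeriv l fun t => V μ f α β t x j) θ| ≤ M j k l x := by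
    rw [ae_distribution_iff h.isDensity]
    filter_upwards [hbound, h.condD1.2, h.condD2] with x h1 h2 h3 hgx
    exact ⟨h2.1 hgx, h3 (h2.1 hgx), h1 (h2.1 hgx)⟩
  -- A measurable set is needed so that cutting off by an indicator gives functions measurable
  -- everywhere, not just almost everywhere.
  obtain ⟨G, hG, hGm, hGx⟩ := hae.exists_measurable_mem
  exact ⟨G, fun x j k l => M j k l x, hGm, hG, hM, hGx⟩

lemma integrable_weightedScore_apply (h : RegularModel μ Θ ω S f g α β θ₀) (hθ : θ ∈ ω)
    (j : Fin p) : Integrable (fun x => weightedScore f α β θ x j) (distribution μ g) := by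
  rw [integrable_distribution_iff h.isDensity]
  refine ((h.condD3 j).2.1.integrable θ hθ).congr (Eventually.of_forall fun x => ?_)
  simp [mul_comm]

lemma integrable_weightedScore (h : RegularModel μ Θ ω S f g α β θ₀) (hθ : θ ∈ ω) :
    Integrable (weightedScore f α β θ) (distribution μ g) :=
  Integrable.of_eval_piLp fun j => h.integrable_weightedScore_apply hθ j

lemma integral_weightedScore (h : RegularModel μ Θ ω S f g α β θ₀) :
    ∫ x, weightedScore f α β θ x ∂(distribution μ g) = xi μ f g α β θ :=
  integral_distribution h.isDensity _

lemma integral_weightedScore_apply (h : RegularModel μ Θ ω S f g α β θ₀) (hθ : θ ∈ ω)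
    (j : Fin p) : ∫ x, weightedScore f α β θ x j ∂(distribution μ g) = xi μ f g α β θ j := by
  rw [← h.integral_weightedScore, eval_integral_piLp fun i => h.integrable_weightedScore_apply hθ i]

lemma centring_apply (h : RegularModel μ Θ ω S f g α β θ₀) (hθ : θ ∈ ω) (j : Fin p) :
    centring μ f α β θ j = ∫ x, weightedScore f α (1 + β) θ x j ∂μ :=
  eval_integral_piLp (fun i => (h.condD3 i).1.1.integrable θ hθ) j

/-- Coordinates commute with the Bochner integral where all coordinates are integrable, which is
known on ω. As ω is open, this local equality suffices for derivatives. -/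
lemma centring_eventuallyEq (h : RegularModel μ Θ ω S f g α β θ₀) (hθ : θ ∈ ω) (j : Fin p) :
    (fun t => centring μ f α β t j) =ᶠ[𝓝 θ] fun t => ∫ x, weightedScore f α (1 + β) t x j ∂μ :=
  (h.isOpen.eventually_mem hθ).mono fun _ ht => h.centring_apply ht j

lemma differentiableAt_centring (h : RegularModel μ Θ ω S f g α β θ₀) (hθ : θ ∈ ω) (j : Fin p) :
    DifferentiableAt ℝ (fun t => centring μ f α β t j) θ :=
  ((h.condD3 j).1.1.differentiableAt θ hθ).congr_of_eventuallyEq (h.centring_eventuallyEq hθ j)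

lemma partialDeriv_centring (h : RegularModel μ Θ ω S f g α β θ₀) (hθ : θ ∈ ω) (j k : Fin p) :
    partialDeriv k (fun t => centring μ f α β t j) θ
      = ∫ x, partialDeriv k (fun t => weightedScore f α (1 + β) t x j) θ ∂μ := by
  rw [partialDeriv_congr (h.centring_eventuallyEq hθ j)]
  exact (h.condD3 j).1.1.partialDeriv_integral θ hθ k

lemma differentiableAt_partialDeriv_centring (h : RegularModel μ Θ ω S f g α β θ₀) (hθ : θ ∈ ω)
    (j k : Fin p) :
    DifferentiableAt ℝ (partialDeriv k fun t => centring μ f α β t j) θ :=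
  (((h.condD3 j).1.2 k).differentiableAt θ hθ).congr_of_eventuallyEq
    ((h.isOpen.eventually_mem hθ).mono fun _ ht => h.partialDeriv_centring ht j k)

lemma differentiableAt_weightedScore (h : RegularModel μ Θ ω S f g α β θ₀) (hx : x ∈ S)
    (hsmooth : ContDiffOn ℝ 3 (fun θ => f θ x) ω) (hθ : θ ∈ ω) (b : ℝ) (j : Fin p) :
    DifferentiableAt ℝ (fun t => weightedScore f α b t x j) θ :=
  ((contDiffOn_weightedScore h.isOpen (h.pos hx) hsmooth α b j).contDiffAt
    (h.isOpen.mem_nhds hθ)).differentiableAt (by norm_num)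

lemma differentiableAt_V (h : RegularModel μ Θ ω S f g α β θ₀) (hx : x ∈ S)
    (hsmooth : ContDiffOn ℝ 3 (fun θ => f θ x) ω) (hθ : θ ∈ ω) (j : Fin p) :
    DifferentiableAt ℝ (fun t => V μ f α β t x j) θ :=
  (h.differentiableAt_weightedScore hx hsmooth hθ β j).sub (h.differentiableAt_centring hθ j)

lemma partialDeriv_V (h : RegularModel μ Θ ω S f g α β θ₀) (hx : x ∈ S)
    (hsmooth : ContDiffOn ℝ 3 (fun θ => f θ x) ω) (hθ : θ ∈ ω) (j k : Fin p) :
    partialDeriv k (fun t => V μ f α β t x j) θ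
      = partialDeriv k (fun t => weightedScore f α β t x j) θ
        - partialDeriv k (fun t => centring μ f α β t j) θ :=
  partialDeriv_sub (h.differentiableAt_weightedScore hx hsmooth hθ β j)
    (h.differentiableAt_centring hθ j) k

lemma differentiableAt_partialDeriv_V (h : RegularModel μ Θ ω S f g α β θ₀) (hx : x ∈ S)
    (hsmooth : ContDiffOn ℝ 3 (fun θ => f θ x) ω) (hθ : θ ∈ ω) (j k : Fin p) :
    DifferentiableAt ℝ (partialDeriv k fun t => V μ f α β t x j) θ := by
  have h1 : DifferentiableAt ℝ (partialDeriv k fun t => weightedScore f α β t x j) θ :=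
    ((contDiffOn_partialDeriv h.isOpen (m := 1)
      (contDiffOn_weightedScore h.isOpen (h.pos hx) hsmooth α β j) (by norm_num) k).contDiffAt
      (h.isOpen.mem_nhds hθ)).differentiableAt (by norm_num)
  exact (h1.sub (h.differentiableAt_partialDeriv_centring hθ j k)).congr_of_eventuallyEq
    ((h.isOpen.eventually_mem hθ).mono fun t ht => h.partialDeriv_V hx hsmooth ht j k)

/-- On G the score is the pointwise limit of difference quotients of log f_θ in θ, each measurable
in x. -/
lemma measurable_indicator_score (h : RegularModel μ Θ ω S f g α β θ₀) {G : Set 𝓧}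
    (hG : MeasurableSet G) (hGx : ∀ x ∈ G, x ∈ S ∧ ContDiffOn ℝ 3 (fun θ => f θ x) ω)
    (hθ : θ ∈ ω) (j : Fin p) : Measurable (G.indicator fun x => score f θ x j) := by
  set v : EuclideanSpace ℝ (Fin p) := EuclideanSpace.single j 1
  have hnear : ∀ᶠ n : ℕ in atTop, θ + (n : ℝ)⁻¹ • v ∈ ω := by
    have htend : Tendsto (fun n : ℕ => θ + (n : ℝ)⁻¹ • v) atTop (𝓝 θ) := by
      simpa using tendsto_const_nhds.add
        ((tendsto_inv_atTop_nhds_zero_nat (𝕜 := ℝ)).smul_const v)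
    exact htend.eventually (h.isOpen.mem_nhds hθ)
  obtain ⟨N, hN⟩ := eventually_atTop.1 hnear
  have hmeas : ∀ t ∈ ω, Measurable fun x => Real.log (f t x) := fun t ht =>
    (h.isDensity_model t (h.subset ht)).measurable.log
  -- The shift by N keeps every parameter in ω, where the densities are known to be measurable.
  refine measurable_of_tendsto_metrizable (f := fun (n : ℕ) => G.indicator fun x =>
    ((n + N : ℕ) : ℝ) • (Real.log (f (θ + ((n + N : ℕ) : ℝ)⁻¹ • v) x) - Real.log (f θ x)))
    (fun n => Measurable.indicator ?_ hG) (tendsto_pi_nhds.2 fun x => ?_)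
  · exact ((hmeas _ (hN (n + N) (by omega))).sub (hmeas θ hθ)).const_smul ((n + N : ℕ) : ℝ)
  · by_cases hx : x ∈ G
    · obtain ⟨hxS, hsm⟩ := hGx x hx
      simp only [Set.indicator_of_mem hx, score_apply]
      have hd : DifferentiableAt ℝ (fun t => Real.log (f t x)) θ :=
        ((hsm.contDiffAt (h.isOpen.mem_nhds hθ)).differentiableAt (by norm_num)).log
          (h.pos hxS θ hθ).ne'
      have hlim := (hd.hasFDerivAt.lim_real v).comp (tendsto_natCast_atTop_atTop (R := ℝ))
      exact hlim.comp (tendsto_add_atTop_nat N)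
    · simp [Set.indicator_of_notMem hx]

lemma measurable_indicator_V (h : RegularModel μ Θ ω S f g α β θ₀) {G : Set 𝓧}
    (hG : MeasurableSet G) (hGx : ∀ x ∈ G, x ∈ S ∧ ContDiffOn ℝ 3 (fun θ => f θ x) ω)
    (hθ : θ ∈ ω) : Measurable (G.indicator (V μ f α β θ)) := by
  have hf := (h.isDensity_model θ (h.subset hθ)).measurable
  have hw : Measurable (weight f α β θ) := (hf.pow_const β).mul (hf.const_mul α).exp
  have heq : G.indicator (V μ f α β θ) = fun x => WithLp.toLp 2 fun j =>
      weight f α β θ x * G.indicator (fun x => score f θ x j) x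
        - G.indicator (fun _ => centring μ f α β θ j) x := by
    ext x j
    by_cases hx : x ∈ G <;> simp [hx, V, weightedScore_apply]
  rw [heq]
  refine (PiLp.continuous_toLp 2 _).measurable.comp (measurable_pi_lambda _ fun j => ?_)
  exact (hw.mul (h.measurable_indicator_score hG hGx hθ j)).sub (measurable_const.indicator hG)

lemma integral_V (h : RegularModel μ Θ ω S f g α β θ₀) [IsProbabilityMeasure (distribution μ g)] :
    ∫ x, V μ f α β θ₀ x ∂(distribution μ g) = 0 := by
  unfold V
  rw [integral_sub (h.integrable_weightedScore h.mem) (integrable_const _),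
    h.integral_weightedScore]
  simpa [IsBestFitting] using h.isBestFitting

/-- On the support, g(x) is a constant factor of a differentiable function. Off it g vanishes almost
everywhere, so no differentiability is needed there. -/
lemma ae_mul_partialDeriv (h : RegularModel μ Θ ω S f g α β θ₀) (j k : Fin p) :
    ∀ᵐ x ∂μ, partialDeriv k (fun t => weightedScore f α β t x j * g x) θ₀
      = g x * partialDeriv k (fun t => weightedScore f α β t x j) θ₀ := by
  filter_upwards [h.condD2, h.ae_density_eq_zero] with x hx hx'
  by_cases hxS : x ∈ S
  · rw [partialDeriv_mul (h.differentiableAt_weightedScore hxS (hx hxS) h.mem β j)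
      (differentiableAt_const _)]
    simp [partialDeriv]
  · simp [hx' hxS, partialDeriv]

lemma integrable_mul_partialDeriv (h : RegularModel μ Θ ω S f g α β θ₀) (j k : Fin p) :
    Integrable (fun x => g x * partialDeriv k (fun t => weightedScore f α β t x j) θ₀) μ :=
  ((h.condD3 j).2.1.integrable_partialDeriv θ₀ h.mem k).congr (h.ae_mul_partialDeriv j k)

lemma ae_partialDeriv_V (h : RegularModel μ Θ ω S f g α β θ₀) (j k : Fin p) :
    (fun x => partialDeriv k (fun t => V μ f α β t x j) θ₀) =ᵐ[distribution μ g]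
      fun x => partialDeriv k (fun t => weightedScore f α β t x j) θ₀
        - partialDeriv k (fun t => centring μ f α β t j) θ₀ := by
  obtain ⟨G, M, -, hG, -, hGx⟩ := h.exists_measurable_regular
  filter_upwards [hG] with x hx
  exact h.partialDeriv_V (hGx x hx).1 (hGx x hx).2.1 h.mem j k

lemma integrable_partialDeriv_weightedScore (h : RegularModel μ Θ ω S f g α β θ₀) (j k : Fin p) :
    Integrable (fun x => partialDeriv k (fun t => weightedScore f α β t x j) θ₀)
      (distribution μ g) :=
  (integrable_distribution_iff h.isDensity).2 (h.integrable_mul_partialDeriv j k)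

lemma integrable_partialDeriv_V (h : RegularModel μ Θ ω S f g α β θ₀)
    [IsProbabilityMeasure (distribution μ g)] (j k : Fin p) :
    Integrable (fun x => partialDeriv k (fun t => V μ f α β t x j) θ₀) (distribution μ g) :=
  ((h.integrable_partialDeriv_weightedScore j k).sub (integrable_const _)).congr
    (h.ae_partialDeriv_V j k).symm

/-- The mean Jacobian of the estimating function at the best-fitting parameter is `-J`. -/
lemma integral_partialDeriv_V (h : RegularModel μ Θ ω S f g α β θ₀)
    [IsProbabilityMeasure (distribution μ g)] (j k : Fin p) :
    ∫ x, partialDeriv k (fun t => V μ f α β t x j) θ₀ ∂(distribution μ g)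
      = -J μ f g α β θ₀ j k := by
  have hint := (h.condD3 j).1.1.integrable_partialDeriv θ₀ h.mem k
  rw [integral_congr_ae (h.ae_partialDeriv_V j k),
    integral_sub (h.integrable_partialDeriv_weightedScore j k) (integrable_const _),
    integral_distribution h.isDensity, h.partialDeriv_centring h.mem]
  simp only [integral_const, probReal_univ, smul_eq_mul, one_mul]
  rw [← integral_sub (h.integrable_mul_partialDeriv j k) hint, J, Matrix.of_apply,
    ← integral_add (h.condD4.1 j k).1 (h.condD4.1 j k).2, ← integral_neg]
  refine integral_congr_ae ?_
  filter_upwards [h.condD2, h.ae_density_eq_zero] with x hx hx'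
  by_cases hxS : x ∈ S
  · exact jacobian_integrand_eq h.isOpen (h.pos hxS) (hx hxS) g α β h.mem j k
  -- Off the support the density vanishes for all parameters in ω, so every term is zero.
  · have hz := h.eq_zero hxS
    rw [partialDeriv_weightedScore_eq_zero h.isOpen hz _ _ h.mem,
      partialDeriv_weightedScore_eq_zero h.isOpen hz _ _ h.mem,
      jRemainder_eq_zero h.isOpen hz g _ _ h.mem, score_eq_zero h.isOpen hz h.mem]
    simp

lemma weightedScore_mul_weightedScore (h : RegularModel μ Θ ω S f g α β θ₀) (x : 𝓧)
    (j k : Fin p) : weightedScore f α β θ₀ x j * weightedScore f α β θ₀ x k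
      = score f θ₀ x j * score f θ₀ x k * weight f (2 * α) (2 * β) θ₀ x := by
  rw [← weight_sq ((h.isDensity_model θ₀ (h.subset h.mem)).nonneg x), weightedScore_apply,
    weightedScore_apply]
  ring

/-- The diagonal integrals in K are the second moments of the weighted score. -/
lemma memLp_weightedScore (h : RegularModel μ Θ ω S f g α β θ₀) (j : Fin p) :
    MemLp (fun x => weightedScore f α β θ₀ x j) 2 (distribution μ g) := by
  rw [memLp_two_iff_integrable_sq
    (h.integrable_weightedScore_apply h.mem j).aestronglyMeasurable,
    integrable_distribution_iff h.isDensity]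
  refine (h.kExists j j).congr (Eventually.of_forall fun x => ?_)
  simp only [sq, h.weightedScore_mul_weightedScore, smul_eq_mul]
  ring

/-- `K` is the covariance matrix of the weighted score at the best-fitting parameter. -/
lemma covariance_weightedScore (h : RegularModel μ Θ ω S f g α β θ₀)
    [IsProbabilityMeasure (distribution μ g)] (j k : Fin p) :
    cov[fun x => weightedScore f α β θ₀ x j, fun x => weightedScore f α β θ₀ x k;
      distribution μ g] = K μ f g α β θ₀ j k := by
  rw [covariance_eq_sub (h.memLp_weightedScore j) (h.memLp_weightedScore k),
    h.integral_weightedScore_apply h.mem, h.integral_weightedScore_apply h.mem,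
    integral_distribution h.isDensity, K, Matrix.of_apply]
  congr 1
  refine integral_congr_ae (Eventually.of_forall fun x => ?_)
  simp only [Pi.mul_apply, h.weightedScore_mul_weightedScore, smul_eq_mul]
  ring

open scoped Matrix RealInnerProductSpace

lemma variance_inner_V (h : RegularModel μ Θ ω S f g α β θ₀)
    [IsProbabilityMeasure (distribution μ g)] (s : EuclideanSpace ℝ (Fin p)) :
    Var[fun x => ⟪V μ f α β θ₀ x, s⟫; distribution μ g]
      = s ⬝ᵥ K μ f g α β θ₀ *ᵥ s := by
  have hL : ∀ j, MemLp (fun x => s j * weightedScore f α β θ₀ x j) 2 (distribution μ g) :=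
    fun j => (h.memLp_weightedScore j).const_mul _
  have heq : (fun x => ⟪V μ f α β θ₀ x, s⟫) = fun x =>
      (∑ j, s j * weightedScore f α β θ₀ x j) - ⟪centring μ f α β θ₀, s⟫ := by
    ext x
    rw [V, inner_sub_left]
    simp [PiLp.inner_apply]
  rw [heq, variance_sub_const (memLp_finsetSum _ fun j _ => hL j).aestronglyMeasurable,
    variance_fun_sum' fun j _ => hL j]
  simp only [covariance_const_mul_left, covariance_const_mul_right, h.covariance_weightedScore,
    dotProduct, Matrix.mulVec, Finset.mul_sum]
  refine Finset.sum_congr rfl fun j _ => Finset.sum_congr rfl fun k _ => ?_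
  ring

/-- The quadratic form of K at `s` is the variance of ⟪V, s⟫. -/
lemma posSemidef_K (h : RegularModel μ Θ ω S f g α β θ₀)
    [IsProbabilityMeasure (distribution μ g)] : (K μ f g α β θ₀).PosSemidef := by
  refine .of_dotProduct_mulVec_nonneg ?_ fun s => ?_
  · ext j k
    simp only [Matrix.conjTranspose_apply, star_trivial, ← h.covariance_weightedScore]
    exact covariance_comm _ _
  · rw [star_trivial]
    exact (variance_nonneg _ _).trans_eq (h.variance_inner_V (WithLp.toLp 2 s))

lemma posSemidef_sandwich (h : RegularModel μ Θ ω S f g α β θ₀)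
    [IsProbabilityMeasure (distribution μ g)] :
    ((J μ f g α β θ₀)⁻¹ * K μ f g α β θ₀ * (J μ f g α β θ₀)⁻¹).PosSemidef := by
  have := h.posSemidef_K.mul_mul_conjTranspose_same (J μ f g α β θ₀)⁻¹
  rwa [h.condD4.2.isHermitian.inv.eq] at this

end RegularModel

/-! ### Operators through their matrix entries -/

section Operators

variable {p : ℕ} {𝓧 : Type*} [MeasurableSpace 𝓧] {Q : Measure 𝓧}

/-- Reduces equality and integrability of operator-valued functions to scalar entries, the form in
which the model assumptions are stated. -/
lemma clm_eq_sum_single (L : EuclideanSpace ℝ (Fin p) →L[ℝ] EuclideanSpace ℝ (Fin p)) :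
    L = ∑ k, ∑ j, L (EuclideanSpace.single k 1) j •
      (EuclideanSpace.proj k : EuclideanSpace ℝ (Fin p) →L[ℝ] ℝ).smulRight
        (EuclideanSpace.single j (1 : ℝ)) := by
  ext1 v
  conv_lhs => rw [euclidean_eq_sum_single v, map_sum]
  rw [_root_.sum_apply]
  refine Finset.sum_congr rfl fun k _ => ?_
  conv_lhs => rw [map_smul, euclidean_eq_sum_single (L _), Finset.smul_sum]
  rw [_root_.sum_apply]
  refine Finset.sum_congr rfl fun j _ => ?_
  simp [smul_smul, mul_comm]

lemma clm_ext_entries {L L' : EuclideanSpace ℝ (Fin p) →L[ℝ] EuclideanSpace ℝ (Fin p)}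
    (h : ∀ k j, L (EuclideanSpace.single k 1) j = L' (EuclideanSpace.single k 1) j) : L = L' := by
  rw [clm_eq_sum_single L, clm_eq_sum_single L']
  simp only [h]

lemma integrable_clm_of_entries
    {A : 𝓧 → EuclideanSpace ℝ (Fin p) →L[ℝ] EuclideanSpace ℝ (Fin p)}
    (h : ∀ k j, Integrable (fun x => A x (EuclideanSpace.single k 1) j) Q) : Integrable A Q := by
  have hsum := integrable_finsetSum Finset.univ fun k _ => integrable_finsetSum Finset.univ
    fun j _ => (h k j).smul_const ((EuclideanSpace.proj k :
      EuclideanSpace ℝ (Fin p) →L[ℝ] ℝ).smulRight (EuclideanSpace.single j (1 : ℝ)))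
  exact hsum.congr (Eventually.of_forall fun x => (clm_eq_sum_single (A x)).symm)

lemma toEuclideanCLM_single_apply (B : Matrix (Fin p) (Fin p) ℝ) (k j : Fin p) :
    Matrix.toEuclideanCLM (𝕜 := ℝ) B (EuclideanSpace.single k 1) j = B j k := by
  rw [EuclideanSpace.single, Matrix.toEuclideanCLM_toLp]
  simp

end Operators

/-! ### V as a regular estimating function, and its influence functions -/

namespace RegularModel

variable {p : ℕ} {𝓧 : Type*} [MeasurableSpace 𝓧] {μ : Measure 𝓧}
  {Θ ω : Set (EuclideanSpace ℝ (Fin p))} {S : Set 𝓧} {f : EuclideanSpace ℝ (Fin p) → 𝓧 → ℝ}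
  {g : 𝓧 → ℝ} {α β : ℝ} {θ₀ θ : EuclideanSpace ℝ (Fin p)} {x : 𝓧}

/-- Restricted to a measurable set of full measure, `V` is a regular estimating function. -/
theorem exists_regularEstimatingFunction (h : RegularModel μ Θ ω S f g α β θ₀)
    [IsProbabilityMeasure (distribution μ g)] :
    ∃ (G : Set 𝓧) (A : 𝓧 → EuclideanSpace ℝ (Fin p) →L[ℝ] EuclideanSpace ℝ (Fin p))
      (M : 𝓧 → ℝ) (r₀ : ℝ), (∀ᵐ x ∂(distribution μ g), x ∈ G) ∧
      Metric.closedBall θ₀ r₀ ⊆ ω ∧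
      RegularEstimatingFunction (distribution μ g) (fun θ => G.indicator (V μ f α β θ)) A M
        (Matrix.toEuclideanCLM (𝕜 := ℝ) (J μ f g α β θ₀)) θ₀ r₀ := by
  obtain ⟨G, M, hGm, hG, hM, hGx⟩ := h.exists_measurable_regular
  obtain ⟨r₀, hr₀, hball⟩ := Metric.nhds_basis_closedBall.mem_iff.1 (h.isOpen.mem_nhds h.mem)
  have hGsm : ∀ x ∈ G, x ∈ S ∧ ContDiffOn ℝ 3 (fun θ => f θ x) ω := fun x hx =>
    ⟨(hGx x hx).1, (hGx x hx).2.1⟩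
  have hentry : ∀ k j, (fun x => G.indicator (fun x => fderiv ℝ (fun t => V μ f α β t x) θ₀) x
      (EuclideanSpace.single k 1) j) =ᵐ[distribution μ g]
      fun x => partialDeriv k (fun t => V μ f α β t x j) θ₀ := fun k j => by
    filter_upwards [hG] with x hx
    obtain ⟨hxS, hsm⟩ := hGsm x hx
    rw [Set.indicator_of_mem hx, fderiv_euclidean_apply (differentiableAt_euclidean.2 fun i =>
      h.differentiableAt_V hxS hsm h.mem i), partialDeriv]
  have hAint : Integrable (G.indicator fun x => fderiv ℝ (fun t => V μ f α β t x) θ₀)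
      (distribution μ g) :=
    integrable_clm_of_entries fun k j => (h.integrable_partialDeriv_V j k).congr (hentry k j).symm
  have hVae : G.indicator (V μ f α β θ₀) =ᵐ[distribution μ g] V μ f α β θ₀ :=
    hG.mono fun x hx => Set.indicator_of_mem hx _
  -- The function, its derivative and the bound are all cut off by the same set, so the expansion
  -- holds trivially outside it.
  refine ⟨G, G.indicator fun x => fderiv ℝ (fun t => V μ f α β t x) θ₀,
    G.indicator fun x => ∑ j, ∑ l, ∑ k, M x j k l, r₀, hG, hball, ?_⟩
  exact
    { pos := hr₀
      measurable := fun θ hθ => h.measurable_indicator_V hGm hGsm (hball hθ)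
      integrable_deriv := hAint
      integral_deriv := by
        refine clm_ext_entries fun k j => ?_
        rw [ContinuousLinearMap.integral_apply hAint, eval_integral_piLp fun i =>
          (h.integrable_partialDeriv_V i k).congr (hentry k i).symm,
          integral_congr_ae (hentry k j), h.integral_partialDeriv_V]
        simp [toEuclideanCLM_single_apply]
      integrable_bound := (integrable_finsetSum _ fun j _ => integrable_finsetSum _ fun l _ =>
        integrable_finsetSum _ fun k _ => hM j k l).indicator hGm
      bound_nonneg := fun x => Set.indicator_nonneg (fun x hx =>
        Finset.sum_nonneg fun j _ => Finset.sum_nonneg fun l _ => Finset.sum_nonneg fun k _ =>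
          (abs_nonneg _).trans ((hGx x hx).2.2 θ₀ h.mem j k l)) x
      linearization := fun x ρ hρ θ hθ θ' hθ' => by
        by_cases hx : x ∈ G
        · obtain ⟨hxS, hsm, hbound⟩ := hGx x hx
          simp only [Set.indicator_of_mem hx]
          exact norm_sub_sub_fderiv_le ((Metric.closedBall_subset_closedBall hρ).trans hball)
            (fun t ht j => h.differentiableAt_V hxS hsm ht j)
            (fun t ht j l => h.differentiableAt_partialDeriv_V hxS hsm ht j l) hbound hθ hθ'
        · simp [Set.indicator_of_notMem hx]
      integrable := (((h.integrable_weightedScore h.mem).sub (integrable_const _)).congr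
        hVae.symm)
      integral_eq_zero := by rw [integral_congr_ae hVae, h.integral_V] }

variable {Ω : Type*} [MeasurableSpace Ω] {P : Measure Ω} [IsProbabilityMeasure P]

open scoped Matrix RealInnerProductSpace in
/-- The central limit theorem for the influence functions `J⁻¹ V`. -/
lemma tendstoInDistribution_influence (h : RegularModel μ Θ ω S f g α β θ₀)
    [IsProbabilityMeasure (distribution μ g)] {X : ℕ → Ω → 𝓧} (hindep : iIndepFun X P)
    (hlaw : ∀ i, HasLaw (X i) (distribution μ g) P) {ψ : 𝓧 → EuclideanSpace ℝ (Fin p)}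
    (hψ : ψ =ᵐ[distribution μ g] V μ f α β θ₀) :
    TendstoInDistribution (fun (n : ℕ) w => (√n)⁻¹ • ∑ k ∈ Finset.range n,
        Matrix.toEuclideanCLM (𝕜 := ℝ) (J μ f g α β θ₀)⁻¹ (ψ (X k w))) atTop
      (id : EuclideanSpace ℝ (Fin p) → EuclideanSpace ℝ (Fin p)) (fun _ => P)
      (multivariateGaussian 0
        ((J μ f g α β θ₀)⁻¹ * K μ f g α β θ₀ * (J μ f g α β θ₀)⁻¹)) := by
  set L := Matrix.toEuclideanCLM (𝕜 := ℝ) (J μ f g α β θ₀)⁻¹ with hL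
  have hJinv : ((J μ f g α β θ₀)⁻¹).IsHermitian := h.condD4.2.isHermitian.inv
  have hJsymm : ((J μ f g α β θ₀)⁻¹)ᵀ = (J μ f g α β θ₀)⁻¹ := by
    rw [← Matrix.conjTranspose_eq_transpose_of_trivial, hJinv.eq]
  have hLadj : ContinuousLinearMap.adjoint L = L :=
    (IsSelfAdjoint.map (show IsSelfAdjoint (J μ f g α β θ₀)⁻¹ from hJinv)
      (Matrix.toEuclideanCLM (𝕜 := ℝ))).adjoint_eq
  have hVint : Integrable (V μ f α β θ₀) (distribution μ g) :=
    (h.integrable_weightedScore h.mem).sub (integrable_const _)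
  have hψm : AEMeasurable ψ (distribution μ g) := hVint.aemeasurable.congr hψ.symm
  have hLψm : AEMeasurable (fun x => L (ψ x)) (distribution μ g) :=
    L.continuous.measurable.comp_aemeasurable hψm
  have hVLp : MemLp (V μ f α β θ₀) 2 (distribution μ g) :=
    (MemLp.of_eval_piLp h.memLp_weightedScore).sub (memLp_const _)
  have hmem : MemLp (fun x => L (ψ x)) 2 (distribution μ g) :=
    L.comp_memLp' ((memLp_congr_ae hψ).2 hVLp)
  refine tendstoInDistribution_inv_sqrt_smul_sum h.posSemidef_sandwich (fun t => ?_) ?_ ?_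
    (iIndepFun_comp_of_hasLaw hindep hlaw hLψm) (identDistrib_comp_of_hasLaw hlaw hLψm)
  -- J⁻¹ is self-adjoint and moves to `t`, so the variance is the form of K at J⁻¹ t, that is, the
  -- form of J⁻¹ K J⁻¹ at `t`.
  · have hinner : (fun x => ⟪L (ψ x), t⟫) =ᵐ[distribution μ g]
        fun x => ⟪V μ f α β θ₀ x, L t⟫ := hψ.mono fun x hx => by
      simp only [hx]
      have hadj := ContinuousLinearMap.adjoint_inner_left L t (V μ f α β θ₀ x)
      rwa [hLadj] at hadj
    have hlawL : Var[fun w => ⟪L (ψ (X 0 w)), t⟫; P]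
        = Var[fun x => ⟪L (ψ x), t⟫; distribution μ g] := by
      rw [← (hlaw 0).map_eq, variance_map ?_ (hlaw 0).aemeasurable]
      · rfl
      · rw [(hlaw 0).map_eq]
        exact (hmem.inner_const t).aestronglyMeasurable.aemeasurable
    rw [hlawL, variance_congr hinner, h.variance_inner_V, hL, Matrix.ofLp_toEuclideanCLM,
      ← Matrix.mulVec_mulVec, ← Matrix.mulVec_mulVec,
      Matrix.dotProduct_mulVec t.ofLp (J μ f g α β θ₀)⁻¹, ← Matrix.mulVec_transpose, hJsymm]
  · have hint : ∫ w, L (ψ (X 0 w)) ∂P = ∫ x, L (ψ x) ∂(distribution μ g) :=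
      (hlaw 0).integral_comp hmem.aestronglyMeasurable
    rw [hint, L.integral_comp_comm (hVint.congr hψ.symm), integral_congr_ae hψ, h.integral_V,
      map_zero]
  · rw [← (hlaw 0).map_eq] at hmem
    exact hmem.comp_of_map (hlaw 0).aemeasurable

end RegularModel

/-- For a sample in `G`, the mean of `V` over the sample is the left side of the estimating
equation. -/
lemma sampleMean_indicator_V {p : ℕ} {𝓧 : Type*} [MeasurableSpace 𝓧] (μ : Measure 𝓧)
    (f : EuclideanSpace ℝ (Fin p) → 𝓧 → ℝ) (α β : ℝ) {G : Set 𝓧} {θ : EuclideanSpace ℝ (Fin p)}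
    {n : ℕ} (hn : n ≠ 0) {x : Fin n → 𝓧} (hx : ∀ i, x i ∈ G) :
    sampleMean (G.indicator (V μ f α β θ)) x
      = (n : ℝ)⁻¹ • ∑ i, weightedScore f α β θ (x i) - centring μ f α β θ := by
  have hn' : (n : ℝ) ≠ 0 := Nat.cast_ne_zero.2 hn
  simp only [sampleMean, Set.indicator_of_mem (hx _), V, Finset.sum_sub_distrib, smul_sub]
  simp [← Nat.cast_smul_eq_nsmul ℝ, smul_smul, hn']

end GBEDE

/-! ### Consistency and asymptotic normality -/

theorem theorem1 {p : ℕ} {𝓧 : Type*} [MeasurableSpace 𝓧] (μ : Measure 𝓧) [SigmaFinite μ]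
    (Θ ω : Set (EuclideanSpace ℝ (Fin p))) (S : Set 𝓧)
    (f : EuclideanSpace ℝ (Fin p) → 𝓧 → ℝ) (g : 𝓧 → ℝ)
    (α β : ℝ) (hβ : 0 ≤ β) (θ₀ : EuclideanSpace ℝ (Fin p))
    (hf : ∀ θ ∈ Θ, GBEDE.IsDensity μ (f θ)) (hg : GBEDE.IsDensity μ g)
    (hω : IsOpen ω) (hωΘ : ω ⊆ Θ) (hθω : θ₀ ∈ ω)
    (hθ₀ : GBEDE.IsBestFitting μ f g α β θ₀)
    (hK : GBEDE.KExists μ f g α β θ₀)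
    (hD1 : GBEDE.CondD1 μ f g Θ S)
    (hD2 : GBEDE.CondD2 μ f ω S)
    (hD3 : GBEDE.CondD3 μ f g α β ω)
    (hD4 : GBEDE.CondD4 μ f g α β θ₀)
    (hD5 : GBEDE.CondD5 μ f g α β ω S)
    {Ω : Type*} [MeasurableSpace Ω] (P : Measure Ω) [IsProbabilityMeasure P]
    (X : ℕ → Ω → 𝓧) (hindep : iIndepFun X P)
    (hlaw : ∀ i, HasLaw (X i) (GBEDE.distribution μ g) P) :
    (∃ T : (n : ℕ) → (Fin n → 𝓧) → EuclideanSpace ℝ (Fin p),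
      (∀ n, Measurable (T n)) ∧
      GBEDE.IsConsistentRootSequence P X μ f Θ α β θ₀
        (fun n w => T n (fun i : Fin n => X i w))) ∧
    ((GBEDE.J μ f g α β θ₀)⁻¹ * GBEDE.K μ f g α β θ₀ * (GBEDE.J μ f g α β θ₀)⁻¹).PosSemidef ∧
    ∀ θhat : ℕ → Ω → EuclideanSpace ℝ (Fin p),
      GBEDE.IsConsistentRootSequence P X μ f Θ α β θ₀ θhat →
      TendstoInDistribution (fun (n : ℕ) w => Real.sqrt n • (θhat n w - θ₀)) atTop
        (id : EuclideanSpace ℝ (Fin p) → EuclideanSpace ℝ (Fin p)) (fun _ => P)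
        (multivariateGaussian 0
          ((GBEDE.J μ f g α β θ₀)⁻¹ * GBEDE.K μ f g α β θ₀ * (GBEDE.J μ f g α β θ₀)⁻¹)) := by
  have hX0 := hlaw 0
  have hQ : IsProbabilityMeasure (GBEDE.distribution μ g) := by
    rw [← hX0.map_eq]
    exact Measure.isProbabilityMeasure_map hX0.aemeasurable
  have h : GBEDE.RegularModel μ Θ ω S f g α β θ₀ :=
    ⟨hf, hg, hω, hωΘ, hθω, hθ₀, hK, hD1, hD2, hD3, hD4, hD5⟩
  obtain ⟨G, A, M, r₀, hG, hball, hreg⟩ := h.exists_regularEstimatingFunction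
  have hJdet : IsUnit (GBEDE.J μ f g α β θ₀).det := hD4.2.isUnit.map Matrix.detMonoidHom
  have hGJ : Matrix.toEuclideanCLM (𝕜 := ℝ) (GBEDE.J μ f g α β θ₀)⁻¹
      ∘L Matrix.toEuclideanCLM (𝕜 := ℝ) (GBEDE.J μ f g α β θ₀) = .id ℝ _ := by
    rw [← ContinuousLinearMap.mul_def, ← map_mul, Matrix.nonsing_inv_mul _ hJdet, map_one]
    rfl
  have hJG : Matrix.toEuclideanCLM (𝕜 := ℝ) (GBEDE.J μ f g α β θ₀)
      ∘L Matrix.toEuclideanCLM (𝕜 := ℝ) (GBEDE.J μ f g α β θ₀)⁻¹ = .id ℝ _ := by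
    rw [← ContinuousLinearMap.mul_def, ← map_mul, Matrix.mul_nonsing_inv _ hJdet, map_one]
    rfl
  have hXG : P {w | ¬ ∀ i, X i w ∈ G} = 0 := by
    have hae : ∀ᵐ w ∂P, ∀ i, X i w ∈ G := ae_all_iff.2 fun i => by
      have hGi := hG
      rw [← (hlaw i).map_eq] at hGi
      exact ae_of_ae_map (hlaw i).aemeasurable hGi
    exact hae
  have hnull : Tendsto (fun _ : ℕ => P {w | ¬ ∀ i, X i w ∈ G}) atTop (𝓝 0) := by
    rw [hXG]; exact tendsto_const_nhds
  refine ⟨?_, h.posSemidef_sandwich, fun θhat hθhat => ?_⟩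
  · obtain ⟨T, hTm, hTroot, hTcons⟩ := hreg.exists_measurable_zero hGJ hJG hindep hlaw
    refine ⟨T, hTm, fun n => (hTm n).comp_aemeasurable (aemeasurable_pi_lambda _ fun i =>
      (hlaw i).aemeasurable), ?_, hTcons⟩
    -- The empty sample is discarded: its sample mean of V is 0, while the left side of the equation
    -- is minus the centring term.
    have hzero : Tendsto (fun n : ℕ => P {w | n = 0}) atTop (𝓝 0) :=
      tendsto_const_nhds.congr' ((eventually_ne_atTop 0).mono fun n hn => by simp [hn])
    refine GBEDE.tendsto_measure_zero_of_subset_union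
      (GBEDE.tendsto_measure_zero_of_subset_union hTroot hnull fun _ => subset_rfl) hzero
      fun n w hw => ?_
    by_contra hcon
    simp only [Set.mem_union, Set.mem_ofPred_eq, not_or, not_not] at hcon
    obtain ⟨⟨⟨hTball, hT0⟩, hwG⟩, hn⟩ := hcon
    refine hw ⟨hωΘ (hball hTball), ?_⟩
    rw [← GBEDE.sampleMean_indicator_V μ f α β hn fun i => hwG i]
    exact hT0
  · refine hreg.tendstoInDistribution hGJ hindep hlaw
      (h.tendstoInDistribution_influence hindep hlaw (hG.mono fun x hx => Set.indicator_of_mem hx _))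
      hθhat.aemeasurable ?_ hθhat.consistent
    have hzero : Tendsto (fun n : ℕ => P {w | n = 0}) atTop (𝓝 0) :=
      tendsto_const_nhds.congr' ((eventually_ne_atTop 0).mono fun n hn => by simp [hn])
    refine GBEDE.tendsto_measure_zero_of_subset_union
      (GBEDE.tendsto_measure_zero_of_subset_union hθhat.root hnull fun _ => subset_rfl) hzero
      fun n w hw => ?_
    by_contra hcon
    simp only [Set.mem_union, Set.mem_ofPred_eq, not_or, not_not] at hcon
    obtain ⟨⟨hroot, hwG⟩, hn⟩ := hcon
    exact hw ((GBEDE.sampleMean_indicator_V μ f α β hn fun i => hwG i).trans hroot.2)
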